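/- A $(D_L,D_R)$-biregular bipartite graph on $[N]\sqcup[M]$ is given by its left neighborhood function $\Gamma_L:[N]\times[D_L]\to[M]$ and its right neighborhood function $\Gamma_R:[M]\times[D_R]\to[N]$, where $\Gamma_L(x,\cdot)$ and $\Gamma_R(w,\cdot)$ list without repetition the neighbors of $x\in[N]$ and of $w\in[M]$. It is a two-sided $(K_L,\varepsilon_L,K_R,\varepsilon_R)$-lossless expander if $|\Gamma_L(S)|\ge(1-\varepsilon_L)D_L|S|$ for all $S\subseteq[N]$ with $|S|\le K_L$, and $|\Gamma_R(T)|\ge(1-\varepsilon_R)D_R|T|$ for all $T\subseteq[M]$ with $|T|\le K_R$. **Theorem.** There are a strictly increasing sequence $N_0<N_1<N_2<\cdots$ of natural numbers, a constant $C$, and a sequence $\eta_n\to0$ such that the following holds. For every constant $0<\delta<0.99$ and all sufficiently large $n$ (depending on $\delta$), writing $N=N_n$, there is an explicit biregular two-sided $(K_L,\ \varepsilon_L=0.01,\ K_R,\ \varepsilon_R=0.01)$-lossless expander $\Gamma_L:[N]\times[D_L]\to[M]$ with $$D_L\le C\log^{204}N,\qquad N^{1.01\delta-\eta_n}\le M\le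 D_L\cdot N^{1.01\delta},$$ $$K_L=N^{\delta},\qquad K_R=\frac1{50}\cdot\frac1{D_L}\cdot\min\left(M,\frac NM\right).$$ Explicit means: there are fixed programs, independent of $n$ and $\delta$, that on input $n$ and $\lfloor N^\delta\rfloor$ compute $N$, $D_L$ and $M$, that on further input $(x,i)\in[N]\times[D_L]$ compute $\Gamma_L(x,i)$, and that on further input $(w,j)\in[M]\times[D_R]$ compute $\Gamma_R(w,j)$, all in time (bit cost) polynomial in $\log N$, with a polynomial independent of $n$ and $\delta$. -/

import Mathlib

/-! ### Biregular bipartite graphs and two-sided lossless expansion -/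

/-- A `(D, D')`-biregular bipartite graph with left vertex set `[N]` and right vertex set `[M]`,
given by its left neighborhood function `[N] × [D] → [M]` and its right neighborhood function
`[M] × [D'] → [N]`. Every left vertex has exactly `D` distinct neighbors, every right vertex has
exactly `D'` distinct neighbors, and both functions describe the same set of edges. -/
structure BiregularGraph (N D M D' : ℕ) where
  left : Fin N → Fin D → Fin M
  right : Fin M → Fin D' → Fin N
  left_injective : ∀ x, Function.Injective (left x)
  right_injective : ∀ w, Function.Injective (right w)
  edge_iff : ∀ x w, (∃ i, left x i = w) ↔ (∃ j, right w j = x)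

namespace BiregularGraph

variable {N D M D' : ℕ}

/-- The set of right neighbors of a set of left vertices. -/
def leftNbrs (G : BiregularGraph N D M D') (S : Finset (Fin N)) : Finset (Fin M) :=
  S.biUnion fun x => Finset.univ.image (G.left x)

/-- The set of left neighbors of a set of right vertices. -/
def rightNbrs (G : BiregularGraph N D M D') (T : Finset (Fin M)) : Finset (Fin N) :=
  T.biUnion fun w => Finset.univ.image (G.right w)

/-- The graph is a two-sided `(KL, εL, KR, εR)`-lossless expander. -/
def IsTwoSidedLossless (G : BiregularGraph N D M D') (KL εL KR εR : ℝ) : Prop :=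
  (∀ S : Finset (Fin N), (S.card : ℝ) ≤ KL →
      (1 - εL) * (D : ℝ) * (S.card : ℝ) ≤ ((G.leftNbrs S).card : ℝ)) ∧
  (∀ T : Finset (Fin M), (T.card : ℝ) ≤ KR →
      (1 - εR) * (D' : ℝ) * (T.card : ℝ) ≤ ((G.rightNbrs T).card : ℝ))

end BiregularGraph

/-! ### A machine model with bit cost -/

/-- The arithmetic instructions of the machine. -/
inductive ArithOp
  | add | sub | mul | div | mod

/-- Subtraction is truncated, and `a / 0 = 0`, `a % 0 = a`. -/
def ArithOp.eval : ArithOp → ℕ → ℕ → ℕ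
  | .add, a, b => a + b
  | .sub, a, b => a - b
  | .mul, a, b => a * b
  | .div, a, b => a / b
  | .mod, a, b => a % b

/-- Programs of a random access machine without indirect addressing, in structured form.
Registers are numbered by natural numbers and hold natural numbers. -/
inductive Prog
  /-- write the constant `c` into register `r` -/
  | const (r c : ℕ)
  /-- write the result of the operation on the contents of registers `a`, `b` into register `r` -/
  | arith (op : ArithOp) (r a b : ℕ)
  /-- run the first program, then the second -/
  | seq (p q : Prog)
  /-- if register `r` is nonzero then run `p`, else run `q` -/
  | cond (r : ℕ) (p q : Prog)
  /-- as long as register `r` is nonzero, run `p` -/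
  | loop (r : ℕ) (p : Prog)

/-- `Run p σ σ' t`: started with register contents `σ`, the program `p` halts with register contents
`σ'`, and its running time is `t`. Time is bit cost: every executed instruction is charged
according to the bit lengths of its operands, and an arithmetic instruction is charged the cost of
the schoolbook multiplication or division of its operands. -/
inductive Run : Prog → (ℕ → ℕ) → (ℕ → ℕ) → ℕ → Prop
  | const (r c : ℕ) (σ : ℕ → ℕ) :
      Run (.const r c) σ (Function.update σ r c) (1 + c.size)
  | arith (op : ArithOp) (r a b : ℕ) (σ : ℕ → ℕ) :
      Run (.arith op r a b) σ (Function.update σ r (op.eval (σ a) (σ b)))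
        ((1 + (σ a).size) * (1 + (σ b).size))
  | seq {p q : Prog} {σ σ₁ σ₂ : ℕ → ℕ} {t₁ t₂ : ℕ} :
      Run p σ σ₁ t₁ → Run q σ₁ σ₂ t₂ → Run (.seq p q) σ σ₂ (t₁ + t₂)
  | condTrue {r : ℕ} {p q : Prog} {σ σ' : ℕ → ℕ} {t : ℕ} :
      σ r ≠ 0 → Run p σ σ' t → Run (.cond r p q) σ σ' (1 + (σ r).size + t)
  | condFalse {r : ℕ} {p q : Prog} {σ σ' : ℕ → ℕ} {t : ℕ} :
      σ r = 0 → Run q σ σ' t → Run (.cond r p q) σ σ' (1 + (σ r).size + t)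
  | loopStep {r : ℕ} {p : Prog} {σ σ₁ σ₂ : ℕ → ℕ} {t₁ t₂ : ℕ} :
      σ r ≠ 0 → Run p σ σ₁ t₁ → Run (.loop r p) σ₁ σ₂ t₂ →
        Run (.loop r p) σ σ₂ (1 + (σ r).size + t₁ + t₂)
  | loopExit {r : ℕ} {p : Prog} {σ : ℕ → ℕ} :
      σ r = 0 → Run (.loop r p) σ σ (1 + (σ r).size)

/-- The machine is deterministic: final contents and running time are unique. -/
theorem Run.unique {p : Prog} {σ σ₁ : ℕ → ℕ} {t₁ : ℕ} (h₁ : Run p σ σ₁ t₁) :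
    ∀ {σ₂ : ℕ → ℕ} {t₂ : ℕ}, Run p σ σ₂ t₂ → σ₁ = σ₂ ∧ t₁ = t₂ := by
  induction h₁ with
  | const => intro _ _ h; cases h; exact ⟨rfl, rfl⟩
  | arith => intro _ _ h; cases h; exact ⟨rfl, rfl⟩
  | seq _ _ ih₁ ih₂ =>
    intro _ _ h
    cases h with
    | seq a b =>
      obtain ⟨rfl, rfl⟩ := ih₁ a
      obtain ⟨rfl, rfl⟩ := ih₂ b
      exact ⟨rfl, rfl⟩
  | condTrue hr _ ih =>
    intro _ _ h
    cases h with
    | condTrue _ a => obtain ⟨rfl, rfl⟩ := ih a; exact ⟨rfl, rfl⟩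
    | condFalse h0 _ => exact absurd h0 hr
  | condFalse hr _ ih =>
    intro _ _ h
    cases h with
    | condTrue h0 _ => exact absurd hr h0
    | condFalse _ a => obtain ⟨rfl, rfl⟩ := ih a; exact ⟨rfl, rfl⟩
  | loopStep hr _ _ ih₁ ih₂ =>
    intro _ _ h
    cases h with
    | loopStep _ a b =>
      obtain ⟨rfl, rfl⟩ := ih₁ a
      obtain ⟨rfl, rfl⟩ := ih₂ b
      exact ⟨rfl, rfl⟩
    | loopExit h0 => exact absurd h0 hr
  | loopExit hr =>
    intro _ _ h
    cases h with
    | loopStep h0 _ _ => exact absurd hr h0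
    | loopExit _ => exact ⟨rfl, rfl⟩

/-- Started with the numbers `input` in registers `0, 1, 2, …` (and `0` in all other registers), the
program halts within time `T` with the number `out` in register `0`. -/
def Prog.ComputesWithin (p : Prog) (input : List ℕ) (out T : ℕ) : Prop :=
  ∃ (σ : ℕ → ℕ) (t : ℕ), Run p (fun r => input.getD r 0) σ t ∧ σ 0 = out ∧ t ≤ T

/-! ### Explicit graphs -/

/-- The programs of an explicit construction of bipartite graphs: three programs for the parameters
`N`, `D`, `M`, one for each of the two neighborhood functions, and a constant `c` that determines the
polynomial time bound. -/
structure GraphProgram where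
  leftSize : Prog
  leftDegree : Prog
  rightSize : Prog
  left : Prog
  right : Prog
  c : ℕ

/-- The programs, given the two numbers `n` and `K`, compute the parameters of the graph `G` and
its neighborhood functions in time polynomial in the bit length of `N`, namely
`c * (bit length of N + 1) ^ c`. Here all vertices and edge labels are numbers, as in `[N]`. -/
def GraphProgram.Describes (A : GraphProgram) (n K : ℕ) {N D M D' : ℕ}
    (G : BiregularGraph N D M D') : Prop :=
  let T : ℕ := A.c * (N.size + 1) ^ A.c
  A.leftSize.ComputesWithin [n, K] N T ∧
  A.leftDegree.ComputesWithin [n, K] D T ∧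
  A.rightSize.ComputesWithin [n, K] M T ∧
  (∀ (x : Fin N) (i : Fin D),
    A.left.ComputesWithin [n, K, (x : ℕ), (i : ℕ)] (G.left x i : ℕ) T) ∧
  (∀ (w : Fin M) (j : Fin D'),
    A.right.ComputesWithin [n, K, (w : ℕ), (j : ℕ)] (G.right w j : ℕ) T)

/-!
The graph is the multiplicity code graph over a prime field `ZMod q`. Left vertices are the
polynomials `f` of degree below `n`, right vertices are pairs of a point and an element of
`(ZMod q) ^ s`, and the neighbor of `f` with label `y` is `y` together with the `s`-jet of `f` at
`y`, the first `s` Taylor coefficients there.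

*Left expansion* (`mul_card_le_card_jetImage`). For a small set `S` of polynomials, counting
coefficients gives a nonzero `Q(X, Y₀, …, Y_{s-1})` of low degree which vanishes at all jets of
members of `S`. For `f ∈ S` the univariate polynomial `Q(X, f, f', …)` has degree below `q` and `q`
zeros, so `f` solves the differential equation `Q = 0`. At a point where the derivative `Q'` of `Q`
by its highest variable does not vanish, a solution of degree below `n ≤ q` is determined by its jet
(`eq_of_jet_eq`), so these jets belong to a single pair of a polynomial and a point, and almost all
points are of this kind. The members of `S` that `Q'` annihilates are treated in the same way with
`Q'` in place of `Q`; their jets are different from the former ones because `Q'` vanishes at them.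

*Right expansion* (`two_mul_card_mul_le_card_rightNbrs`). By the Chinese remainder theorem two right
vertices have at most `q ^ (n - 2 * s)` common neighbors (one if `n < 2 * s`), and the Bonferroni
inequality finishes the argument.

*Computation* (`IsParam.describes`). A polynomial is the number with its coefficients as base-`q`
digits. Both neighborhood functions reduce to the Taylor shift `f(X) ↦ f(X + y)`, which is computed
in integers: the value of `f(X + y)` at a number `B` larger than all integer coefficients displays
these coefficients as its base-`B` digits (`digitPoly_numShift`).

*Parameters*. `q` is the least prime above `(n + 2) ^ 204`, and `s + 1` is the least `m` with
`K ^ 101 ≤ q ^ (100 * m)`, where `K = ⌊N ^ δ⌋`. The exponent `204` makes the interpolation step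
possible for sets of size `K` (`mul_lt_div_pow`).
-/


/-! ### Linearization of polynomial maps -/

section MvPoly

open MvPolynomial

/-- If `u` and `w` agree modulo `a ^ (e + 1)` in all variables but one, and modulo `a ^ e` in that
one, then modulo `a ^ (e + 1)` the difference of the values of `Q` is its linear part. -/
theorem MvPolynomial.pow_dvd_aeval_sub_aeval_sub {σ F R : Type*} [CommRing F] [CommRing R]
    [Algebra F R] (Q : MvPolynomial σ F) (a : R) {e : ℕ} (he : 1 ≤ e) (r : σ) (u w : σ → R)
    (huw : ∀ v, v ≠ r → a ^ (e + 1) ∣ u v - w v) (hr : a ^ e ∣ u r - w r) :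
    a ^ (e + 1) ∣ aeval u Q - aeval w Q - (u r - w r) * aeval w (pderiv r Q) := by
  classical
  induction Q using MvPolynomial.induction_on with
  | C c => simp
  | add p q hp hq =>
    have := dvd_add hp hq
    simp only [map_add]
    convert this using 1
    ring
  | mul_X p v hp =>
    by_cases hv : v = r
    · subst hv
      have h1 : a ^ e ∣ aeval u p - aeval w p := by
        have h2 := dvd_add ((pow_dvd_pow a (Nat.le_succ e)).trans hp)
          (hr.mul_right (aeval w (pderiv v p)))
        simpa using h2
      have h3 : a ^ (e + 1) ∣ (u v - w v) * (aeval u p - aeval w p) :=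
        (pow_dvd_pow a (by omega : e + 1 ≤ e + e)).trans (by
          rw [pow_add]; exact mul_dvd_mul hr h1)
      have := dvd_add (hp.mul_right (w v)) h3
      convert this using 1
      simp only [map_mul, aeval_X, Derivation.leibniz, pderiv_X_self, map_add, smul_eq_mul,
        map_one]
      ring
    · have := dvd_add (hp.mul_right (w v)) ((huw v hv).mul_left (aeval u p))
      convert this using 1
      simp only [map_mul, aeval_X, Derivation.leibniz, pderiv_X_of_ne hv, smul_eq_mul,
        mul_zero, zero_add]
      ring

theorem MvPolynomial.pow_dvd_aeval_sub_aeval_sub_of_vars {σ F R : Type*} [CommRing F] [CommRing R]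
    [Algebra F R] (Q : MvPolynomial σ F) (a : R) {e : ℕ} (he : 1 ≤ e) (r : σ) (u w : σ → R)
    (huw : ∀ v ∈ Q.vars, v ≠ r → a ^ (e + 1) ∣ u v - w v) (hr : a ^ e ∣ u r - w r)
    (hrQ : r ∈ Q.vars) :
    a ^ (e + 1) ∣ aeval u Q - aeval w Q - (u r - w r) * aeval w (pderiv r Q) := by
  classical
  set u' : σ → R := fun v => if v ∈ Q.vars then u v else w v with hu'
  have h1 : aeval u Q = aeval u' Q :=
    eval₂Hom_congr' rfl (fun v hv _ => by simp [hu', hv]) rfl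
  have h2 : u r = u' r := by simp [hu', hrQ]
  rw [h1, h2]
  refine pow_dvd_aeval_sub_aeval_sub Q a he r u' w (fun v hv => ?_) (by rwa [← h2])
  by_cases hvQ : v ∈ Q.vars
  · simpa [hu', hvQ] using huw v hvQ hv
  · simp [hu', hvQ]

end MvPoly

/-! ### Jets of univariate polynomials -/

section Jets

open Polynomial

variable {F : Type*} [Field F]

theorem Polynomial.taylor_hasseDeriv_coeff (a : F) (h : F[X]) (i k : ℕ) :
    (taylor a (hasseDeriv i h)).coeff k
      = ((k + i).choose k : F) * (taylor a h).coeff (k + i) := by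
  have := LinearMap.congr_fun (hasseDeriv_comp (R := F) k i) h
  simp only [LinearMap.comp_apply, LinearMap.smul_apply] at this
  rw [taylor_coeff, taylor_coeff, this]
  simp

theorem Polynomial.X_sub_C_pow_dvd_iff_taylor_coeff (a : F) (h : F[X]) (m : ℕ) :
    (X - C a) ^ m ∣ h ↔ ∀ k < m, (taylor a h).coeff k = 0 := by
  rw [X_sub_C_pow_dvd_iff, X_pow_dvd_iff]
  rfl

theorem Nat.cast_choose_ne_zero_of_lt {p : ℕ} [Fact p.Prime] [CharP F p] {k r : ℕ} (hk : k < p)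
    (hr : r ≤ k) : ((k.choose r : ℕ) : F) ≠ 0 := by
  have hp : p.Prime := Fact.out
  rw [Ne, CharP.cast_eq_zero_iff F p]
  intro h
  have h1 : p ∣ k.factorial := by
    rw [← Nat.choose_mul_factorial_mul_factorial hr, mul_assoc]
    exact h.mul_right _
  exact absurd ((hp.dvd_factorial).1 h1) (by omega)

/-- The values substituted for the variables `X, Y₀, …, Y_{s-1}` of a differential polynomial:
the variable `0` stands for `X` and the variable `i + 1` for the `i`-th Hasse derivative of `f`. -/
noncomputable def jetSubst (s : ℕ) (f : F[X]) : Fin (s + 1) → F[X] :=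
  Fin.cons X fun i => hasseDeriv (i : ℕ) f

/-- The `s`-jet of `f` at `a`: the values at `a` of the first `s` Hasse derivatives of `f`. -/
noncomputable def jet (s : ℕ) (f : F[X]) (a : F) : Fin s → F :=
  fun i => (hasseDeriv (i : ℕ) f).eval a

@[simp] theorem jetSubst_zero (s : ℕ) (f : F[X]) : jetSubst s f 0 = X := rfl

@[simp] theorem jetSubst_succ (s : ℕ) (f : F[X]) (i : Fin s) :
    jetSubst s f i.succ = hasseDeriv (i : ℕ) f := rfl

theorem eval_aeval_jetSubst (s : ℕ) (f : F[X]) (a : F) (Q : MvPolynomial (Fin (s + 1)) F) :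
    (MvPolynomial.aeval (jetSubst s f) Q).eval a
      = MvPolynomial.eval (Fin.cons a (jet s f a) : Fin (s + 1) → F) Q := by
  have h : (Polynomial.evalRingHom a).comp
      ((MvPolynomial.aeval (jetSubst s f) : MvPolynomial (Fin (s + 1)) F →ₐ[F] F[X]) :
        MvPolynomial (Fin (s + 1)) F →+* F[X])
      = MvPolynomial.eval (Fin.cons a (jet s f a) : Fin (s + 1) → F) := by
    refine MvPolynomial.ringHom_ext (fun c => by simp) fun i => ?_
    refine Fin.cases (by simp) (fun i => by simp [jet]) i
  exact RingHom.congr_fun h Q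

theorem natDegree_aeval_jetSubst_le {s d n : ℕ} {Q : MvPolynomial (Fin (s + 1)) F}
    (hd : ∀ m ∈ Q.support, ∀ v, m v < d) {f : F[X]} (hf : f.natDegree < n) :
    (MvPolynomial.aeval (jetSubst s f) Q).natDegree ≤ (d - 1) * (1 + s * (n - 1)) := by
  rw [MvPolynomial.aeval_def, MvPolynomial.eval₂_eq']
  refine natDegree_sum_le_of_forall_le _ _ fun m hm => ?_
  refine (natDegree_C_mul_le _ _).trans ?_
  refine (natDegree_prod_le _ _).trans ?_
  rw [Fin.sum_univ_succ, mul_add, mul_one]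
  refine add_le_add ?_ ?_
  · rw [jetSubst_zero, natDegree_X_pow]
    have := hd m hm 0
    omega
  · calc ∑ i : Fin s, (jetSubst s f i.succ ^ m i.succ).natDegree
        ≤ ∑ _i : Fin s, (d - 1) * (n - 1) := by
          refine Finset.sum_le_sum fun i _ => natDegree_pow_le.trans ?_
          have h1 := hd m hm i.succ
          refine Nat.mul_le_mul (by omega) ?_
          rw [jetSubst_succ]
          exact (natDegree_hasseDeriv_le f i).trans (by omega)
      _ = (d - 1) * (s * (n - 1)) := by simp; ring

/-- Uniqueness for the differential equation `Q(X, f, f', …) = 0`: where the derivative of `Q` by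
the highest occurring variable `Y_r` does not vanish, the jet determines the solution. The degree
bound by the characteristic keeps the binomial coefficients of the leading terms nonzero. -/
theorem eq_of_jet_eq {p : ℕ} [Fact p.Prime] [CharP F p] {s n : ℕ} (hnp : n ≤ p)
    {Q : MvPolynomial (Fin (s + 1)) F} {r : Fin s} (hr : r.succ ∈ Q.vars)
    (hmax : ∀ i : Fin s, i.succ ∈ Q.vars → i ≤ r) {f g : F[X]} (hf : f.natDegree < n)
    (hg : g.natDegree < n) (hQf : MvPolynomial.aeval (jetSubst s f) Q = 0)
    (hQg : MvPolynomial.aeval (jetSubst s g) Q = 0) {a : F} (hfg : jet s f a = jet s g a)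
    (hsep : (MvPolynomial.aeval (jetSubst s g) (MvPolynomial.pderiv r.succ Q)).eval a ≠ 0) :
    f = g := by
  by_contra hne
  set h : F[X] := f - g with hh
  have hT : taylor a h ≠ 0 := by
    intro h0
    apply sub_ne_zero.mpr hne
    apply taylor_injective a
    rw [map_zero]
    exact h0
  have hex : ∃ k, (taylor a h).coeff k ≠ 0 := by
    by_contra hcon
    push Not at hcon
    exact hT (Polynomial.ext (by simpa using hcon))
  -- `m` is the vanishing order of `f - g` at `a`
  obtain ⟨m, hm, hmin⟩ : ∃ m, (taylor a h).coeff m ≠ 0 ∧ ∀ k < m, (taylor a h).coeff k = 0 := by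
    classical
    exact ⟨Nat.find hex, Nat.find_spec hex, fun k hk => by simpa using Nat.find_min hex hk⟩
  have hmn : m < n := by
    have h1 := le_natDegree_of_ne_zero hm
    rw [natDegree_taylor] at h1
    have h2 : h.natDegree ≤ _ := natDegree_sub_le f g
    have h3 : max f.natDegree g.natDegree < n := max_lt hf hg
    omega
  have hrm : (r : ℕ) < m := by
    by_contra hle
    push Not at hle
    apply hm
    have := congrFun hfg ⟨m, lt_of_le_of_lt hle r.2⟩
    simp only [jet] at this
    rw [taylor_coeff, hh, map_sub, eval_sub, this, sub_self]
  have hdvd : ∀ i, (X - C a) ^ (m - i) ∣ hasseDeriv i h := by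
    intro i
    rw [X_sub_C_pow_dvd_iff_taylor_coeff]
    intro k hk
    rw [taylor_hasseDeriv_coeff, hmin (k + i) (by omega), mul_zero]
  have key := MvPolynomial.pow_dvd_aeval_sub_aeval_sub_of_vars Q (X - C a)
    (e := m - r) (by omega) r.succ (jetSubst s f) (jetSubst s g) (by
      intro v hv
      induction v using Fin.cases with
      | zero => simp
      | succ i =>
        intro hne
        have hir : i < r := lt_of_le_of_ne (hmax i hv) fun h => hne (by rw [h])
        rw [jetSubst_succ, jetSubst_succ, ← map_sub]
        refine (pow_dvd_pow _ ?_).trans (hdvd i)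
        have : (i : ℕ) < r := hir
        omega) (by
      rw [jetSubst_succ, jetSubst_succ, ← map_sub]
      exact hdvd r) hr
  rw [hQf, hQg, jetSubst_succ, jetSubst_succ, ← map_sub, sub_zero, zero_sub, dvd_neg] at key
  have hnd : ¬ (X - C a) ∣
      MvPolynomial.aeval (jetSubst s g) (MvPolynomial.pderiv r.succ Q) := by
    rw [dvd_iff_isRoot]
    exact hsep
  have h2 := (prime_X_sub_C a).pow_dvd_of_dvd_mul_right _ hnd key
  rw [X_sub_C_pow_dvd_iff_taylor_coeff] at h2
  have h3 := h2 (m - r) (by omega)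
  rw [taylor_hasseDeriv_coeff, show m - r + r = m by omega] at h3
  rcases mul_eq_zero.mp h3 with h4 | h4
  · exact Nat.cast_choose_ne_zero_of_lt (F := F) (p := p) (by omega) (by omega) h4
  · exact hm h4

end Jets

/-! ### Expansion of multiplicity codes -/

section Expansion

open Polynomial

variable {F : Type*} [Field F]

theorem card_sub_natDegree_le_card_filter_eval_ne_zero [Fintype F] [DecidableEq F] {P : F[X]}
    (hP : P ≠ 0) :
    Fintype.card F - P.natDegree ≤ (Finset.univ.filter fun a : F => P.eval a ≠ 0).card := by
  have h1 : (Finset.univ.filter fun a : F => P.eval a = 0).card ≤ P.natDegree := by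
    refine le_trans (Finset.card_le_card (t := P.roots.toFinset) ?_)
      ((Multiset.toFinset_card_le _).trans (card_roots' P))
    intro a ha
    simpa [hP] using ha
  have h2 := Finset.card_filter_add_card_filter_not (s := (Finset.univ : Finset F))
    (fun a : F => P.eval a = 0)
  rw [Finset.card_univ] at h2
  simp only [ne_eq]
  omega

/-- The right neighbors of a set of polynomials in the multiplicity code graph: all pairs of a
point and the `s`-jet of a polynomial of the set there. -/
noncomputable def jetImage [Fintype F] [DecidableEq F] (s : ℕ) (S : Finset F[X]) :
    Finset (F × (Fin s → F)) :=
  (S ×ˢ Finset.univ).image fun z => (z.2, jet s z.1 z.2)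

theorem mem_jetImage [Fintype F] [DecidableEq F] {s : ℕ} {S : Finset F[X]}
    {w : F × (Fin s → F)} : w ∈ jetImage s S ↔ ∃ f ∈ S, ∃ a, (a, jet s f a) = w := by
  simp [jetImage]

/-- If a nonzero differential polynomial vanishes on a set of polynomials, the jets of the set are
almost all distinct. The induction replaces the equation by its derivative by the highest variable:
the polynomials annihilated by the derivative are left to the induction hypothesis, and the jets of
the others are counted at the points where the derivative does not vanish. -/
theorem mul_card_le_card_jetImage_of_aeval_eq_zero [Fintype F] [DecidableEq F] {p : ℕ}
    [Fact p.Prime] [CharP F p] {s d n : ℕ} (hnp : n ≤ p) (hdp : d ≤ p) (k : ℕ) :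
    ∀ (Q : MvPolynomial (Fin (s + 1)) F), Q ≠ 0 → (∀ m ∈ Q.support, m.degree ≤ k) →
      (∀ m ∈ Q.support, ∀ v, m v < d) → ∀ S : Finset F[X], (∀ f ∈ S, f.natDegree < n) →
      (∀ f ∈ S, MvPolynomial.aeval (jetSubst s f) Q = 0) →
      (Fintype.card F - (d - 1) * (1 + s * (n - 1))) * S.card ≤ (jetImage s S).card := by
  induction k with
  | zero =>
    intro Q hQ0 hk hd S hS hQS
    have hC : Q = MvPolynomial.C (MvPolynomial.coeff 0 Q) := by
      rw [← MvPolynomial.totalDegree_eq_zero_iff_eq_C, MvPolynomial.totalDegree_eq_zero_iff]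
      intro m hm x
      have := hk m hm
      rw [Nat.le_zero, Finsupp.degree_eq_zero_iff] at this
      simp [this]
    have : S = ∅ := by
      refine Finset.eq_empty_of_forall_notMem fun f hf => hQ0 ?_
      have := hQS f hf
      rw [hC] at this
      simp only [MvPolynomial.aeval_C, algebraMap_eq, C_eq_zero] at this
      rw [hC, this, map_zero]
    simp [this]
  | succ k ih =>
    intro Q hQ0 hk hd S hS hQS
    set A := Fintype.card F - (d - 1) * (1 + s * (n - 1)) with hA
    by_cases hY : ∃ i : Fin s, i.succ ∈ Q.vars
    swap
    · -- without the variables `Y_i` the equation is a nonzero polynomial in `X` alone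
      push Not at hY
      have : S = ∅ := by
        refine Finset.eq_empty_of_forall_notMem fun f hf => hQ0 ?_
        have h1 := hQS f hf
        have h2 : (Polynomial.aeval (MvPolynomial.X 0 : MvPolynomial (Fin (s + 1)) F))
            (MvPolynomial.aeval (jetSubst s f) Q) = Q := by
          rw [← AlgHom.comp_apply, MvPolynomial.comp_aeval]
          conv_rhs => rw [← MvPolynomial.aeval_X_left_apply Q]
          refine MvPolynomial.eval₂Hom_congr' rfl (fun v hv _ => ?_) rfl
          induction v using Fin.cases with
          | zero => simp
          | succ i => exact absurd hv (hY i)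
        rw [← h2, h1, map_zero]
      simp [this]
    obtain ⟨r, hr, hmax⟩ :
        ∃ r : Fin s, r.succ ∈ Q.vars ∧ ∀ i : Fin s, i.succ ∈ Q.vars → i ≤ r := by
      obtain ⟨i, hi⟩ := hY
      have hne : (Finset.univ.filter fun i : Fin s => i.succ ∈ Q.vars).Nonempty :=
        ⟨i, by simpa using hi⟩
      refine ⟨_, by simpa using Finset.max'_mem _ hne, fun j hj =>
        Finset.le_max' (Finset.univ.filter fun i : Fin s => i.succ ∈ Q.vars) j (by simpa using hj)⟩
    set Q' := MvPolynomial.pderiv r.succ Q with hQ'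
    have hsupp : ∀ m ∈ Q'.support, m + Finsupp.single r.succ 1 ∈ Q.support := by
      intro m hm
      rw [MvPolynomial.mem_support_iff, hQ', MvPolynomial.coeff_pderiv] at hm
      rw [MvPolynomial.mem_support_iff]
      exact left_ne_zero_of_mul hm
    have hQ'0 : Q' ≠ 0 := by
      obtain ⟨m, hm, hmr⟩ := (MvPolynomial.mem_vars_iff_mem_support _).mp hr
      intro h0
      have h1 := MvPolynomial.coeff_pderiv (i := r.succ) Q (m - Finsupp.single r.succ 1)
      rw [Finsupp.mem_support_iff] at hmr
      have h2 : m - Finsupp.single r.succ 1 + Finsupp.single r.succ 1 = m := by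
        rw [tsub_add_cancel_of_le]
        simpa [Finsupp.single_le_iff] using Nat.one_le_iff_ne_zero.mpr hmr
      rw [← hQ', h0, MvPolynomial.coeff_zero, h2, eq_comm, mul_eq_zero] at h1
      rcases h1 with h1 | h1
      · exact (MvPolynomial.mem_support_iff.mp hm) h1
      · have h3 : (m r.succ : F) = 0 := by
          rw [← h1, ← Nat.cast_succ]
          conv_lhs => rw [← h2]
          simp
        rw [CharP.cast_eq_zero_iff F p] at h3
        have := Nat.le_of_dvd (Nat.pos_of_ne_zero hmr) h3
        have := hd m hm r.succ
        omega
    have hd' : ∀ m ∈ Q'.support, ∀ v, m v < d := by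
      intro m hm v
      have := hd _ (hsupp m hm) v
      rw [Finsupp.add_apply] at this
      omega
    have hk' : ∀ m ∈ Q'.support, m.degree ≤ k := by
      intro m hm
      have := hk _ (hsupp m hm)
      rw [map_add, Finsupp.degree_single] at this
      omega
    classical
    set S₁ := S.filter fun f => MvPolynomial.aeval (jetSubst s f) Q' = 0 with hS₁
    set S₂ := S.filter fun f => ¬ MvPolynomial.aeval (jetSubst s f) Q' = 0 with hS₂
    have hcard : S₁.card + S₂.card = S.card := Finset.card_filter_add_card_filter_not _
    have ih₁ := ih Q' hQ'0 hk' hd' S₁ (fun f hf => hS f (Finset.mem_filter.mp hf).1)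
      (fun f hf => (Finset.mem_filter.mp hf).2)
    -- the pairs of a polynomial and a point at which the derivative does not vanish
    set G : Finset (Σ _ : F[X], F) := S₂.sigma fun f => Finset.univ.filter fun a =>
      (MvPolynomial.aeval (jetSubst s f) Q').eval a ≠ 0 with hG
    have hGcard : A * S₂.card ≤ G.card := by
      rw [hG, Finset.card_sigma, mul_comm, ← smul_eq_mul, ← Finset.sum_const]
      refine Finset.sum_le_sum fun f hf => ?_
      have hf' := Finset.mem_filter.mp hf
      have h1 := card_sub_natDegree_le_card_filter_eval_ne_zero hf'.2
      have h2 := natDegree_aeval_jetSubst_le hd' (hS f hf'.1)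
      omega
    have hinj : Set.InjOn (fun z : Σ _ : F[X], F => (z.2, jet s z.1 z.2)) G := by
      rintro ⟨f, a⟩ hf ⟨g, b⟩ hg hfg
      simp only [Prod.mk.injEq] at hfg
      obtain ⟨rfl, hfg⟩ := hfg
      simp only [hG, Finset.coe_sigma, Set.mem_sigma_iff, Finset.mem_coe, Finset.mem_filter,
        hS₂, Finset.mem_univ, true_and] at hf hg
      have := eq_of_jet_eq hnp hr hmax (hS f hf.1.1) (hS g hg.1.1) (hQS f hf.1.1) (hQS g hg.1.1)
        hfg hg.2
      rw [this]
    have hdisj : Disjoint (jetImage s S₁)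
        (G.image fun z : Σ _ : F[X], F => (z.2, jet s z.1 z.2)) := by
      rw [Finset.disjoint_left]
      intro w hw hw'
      obtain ⟨f, hf, a, rfl⟩ := mem_jetImage.mp hw
      obtain ⟨⟨g, b⟩, hg, hgw⟩ := Finset.mem_image.mp hw'
      simp only [Prod.mk.injEq] at hgw
      obtain ⟨rfl, hfg⟩ := hgw
      simp only [hG, Finset.mem_sigma, Finset.mem_filter] at hg
      apply hg.2.2
      rw [eval_aeval_jetSubst, hfg, ← eval_aeval_jetSubst, (Finset.mem_filter.mp hf).2, eval_zero]
    have hsub : jetImage s S₁ ∪ (G.image fun z : Σ _ : F[X], F => (z.2, jet s z.1 z.2))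
        ⊆ jetImage s S := by
      intro w hw
      rw [mem_jetImage]
      rcases Finset.mem_union.mp hw with hw | hw
      · obtain ⟨f, hf, a, rfl⟩ := mem_jetImage.mp hw
        exact ⟨f, (Finset.mem_filter.mp hf).1, a, rfl⟩
      · obtain ⟨⟨g, b⟩, hg, rfl⟩ := Finset.mem_image.mp hw
        simp only [hG, Finset.mem_sigma] at hg
        exact ⟨g, (Finset.mem_filter.mp hg.1).1, b, rfl⟩
    have hfin := Finset.card_le_card hsub
    rw [Finset.card_union_of_disjoint hdisj, Finset.card_image_of_injOn hinj] at hfin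
    rw [← hcard, mul_add]
    omega

/-- The exponent vectors with all entries below `d`. -/
noncomputable def boxExponent {s d : ℕ} (c : Fin s → Fin d) : Fin s →₀ ℕ :=
  Finsupp.equivFunOnFinite.symm fun v => (c v : ℕ)

/-- A set of fewer than `d ^ σ` points lies on a hypersurface of degree below `d` in each
variable. -/
theorem exists_mvPolynomial_eval_eq_zero {s d : ℕ} (T : Finset (Fin s → F))
    (hT : T.card < d ^ s) :
    ∃ Q : MvPolynomial (Fin s) F, Q ≠ 0 ∧ (∀ m ∈ Q.support, ∀ v, m v < d) ∧
      ∀ w ∈ T, MvPolynomial.eval w Q = 0 := by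
  classical
  have hbox : Function.Injective (boxExponent : (Fin s → Fin d) → (Fin s →₀ ℕ)) := by
    intro c c' h
    funext v
    have := DFunLike.congr_fun h v
    exact Fin.ext (by simpa [boxExponent] using this)
  let Φ : ((Fin s → Fin d) → F) →ₗ[F] MvPolynomial (Fin s) F :=
    Fintype.linearCombination F fun c => MvPolynomial.monomial (boxExponent c) (1 : F)
  let Ψ : MvPolynomial (Fin s) F →ₗ[F] (T → F) :=
    LinearMap.pi fun w => (MvPolynomial.aeval (w : Fin s → F)).toLinearMap
  have hker : LinearMap.ker (Ψ ∘ₗ Φ) ≠ ⊥ := by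
    apply LinearMap.ker_ne_bot_of_finrank_lt
    simpa using hT
  obtain ⟨c, hc, hc0⟩ := (Submodule.ne_bot_iff _).mp hker
  have hcoeff : ∀ m, MvPolynomial.coeff m (Φ c) = ∑ b, if boxExponent b = m then c b else 0 := by
    intro m
    simp [Φ, Fintype.linearCombination_apply, MvPolynomial.coeff_sum, MvPolynomial.coeff_smul,
      MvPolynomial.coeff_monomial]
  refine ⟨Φ c, ?_, ?_, ?_⟩
  · intro h0
    apply hc0
    funext b
    have := hcoeff (boxExponent b)
    rw [h0, MvPolynomial.coeff_zero] at this
    simpa [hbox.eq_iff] using this.symm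
  · intro m hm v
    rw [MvPolynomial.mem_support_iff, hcoeff] at hm
    obtain ⟨b, _, hb⟩ := Finset.exists_ne_zero_of_sum_ne_zero hm
    have : boxExponent b = m := by
      by_contra h
      simp [h] at hb
    rw [← this]
    simp [boxExponent]
  · intro w hw
    have := congrFun (LinearMap.mem_ker.mp hc) ⟨w, hw⟩
    simpa [Ψ, MvPolynomial.aeval_eq_eval] using this

/-- Left expansion of the multiplicity code graph: at most `K` polynomials of degree below `n` have
almost `q` times as many jets, provided that there are enough differential polynomials of low
degree to interpolate `q * K` jets. -/
theorem mul_card_le_card_jetImage [Fintype F] [DecidableEq F] {p : ℕ} [Fact p.Prime]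
    [CharP F p] {s d n : ℕ} (hnp : n ≤ p) (hdp : d ≤ p)
    (hdeg : (d - 1) * (1 + s * (n - 1)) < Fintype.card F) (S : Finset F[X])
    (hS : ∀ f ∈ S, f.natDegree < n) (hcard : Fintype.card F * S.card < d ^ (s + 1)) :
    (Fintype.card F - (d - 1) * (1 + s * (n - 1))) * S.card ≤ (jetImage s S).card := by
  classical
  have hcard' : ((jetImage s S).image fun w => (Fin.cons w.1 w.2 : Fin (s + 1) → F)).card
      < d ^ (s + 1) := by
    refine lt_of_le_of_lt (Finset.card_image_le.trans Finset.card_image_le) ?_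
    rwa [Finset.card_product, Finset.card_univ, mul_comm]
  obtain ⟨Q, hQ0, hd, hQ⟩ := exists_mvPolynomial_eval_eq_zero _ hcard'
  refine mul_card_le_card_jetImage_of_aeval_eq_zero hnp hdp Q.totalDegree Q hQ0
    (fun m hm => ?_) hd S hS fun f hf => ?_
  · exact MvPolynomial.le_totalDegree hm
  · by_contra hne
    have h1 := card_sub_natDegree_le_card_filter_eval_ne_zero hne
    have h2 := natDegree_aeval_jetSubst_le hd (hS f hf)
    have h3 : (Finset.univ.filter fun a : F =>
        (MvPolynomial.aeval (jetSubst s f) Q).eval a ≠ 0) = ∅ := by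
      refine Finset.filter_eq_empty_iff.mpr fun a _ => ?_
      rw [not_not, eval_aeval_jetSubst]
      exact hQ _ (Finset.mem_image_of_mem _ (mem_jetImage.mpr ⟨f, hf, a, rfl⟩))
    rw [h3, Finset.card_empty] at h1
    omega

end Expansion

/-! ### Polynomials encoded as numbers -/

section Digits

open Polynomial

@[simp] theorem Nat.ofDigits_nil_eq {R : Type*} [Semiring R] (b : R) :
    Nat.ofDigits b [] = 0 := rfl

theorem Nat.ofDigits_cons_eq {R : Type*} [Semiring R] (b : R) (a : ℕ) (L : List ℕ) :
    Nat.ofDigits b (a :: L) = a + b * Nat.ofDigits b L := rfl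

theorem Nat.map_ofDigits_eq {R S : Type*} [Semiring R] [Semiring S] (φ : R →+* S) (b : R)
    (L : List ℕ) : φ (Nat.ofDigits b L) = Nat.ofDigits (φ b) L := by
  induction L with
  | nil => simp
  | cons a L ih => simp [Nat.ofDigits_cons_eq, ih]

theorem Nat.ofDigits_digits_ofDigits {R : Type*} [Semiring R] {B : ℕ} (hB : 1 < B) (β : R)
    (L : List ℕ) (hL : ∀ a ∈ L, a < B) :
    Nat.ofDigits β (Nat.digits B (Nat.ofDigits B L)) = Nat.ofDigits β L := by
  induction L with
  | nil => simp
  | cons a L ih =>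
    have ih' := ih fun b hb => hL b (List.mem_cons_of_mem _ hb)
    have ha := hL a List.mem_cons_self
    rw [Nat.ofDigits_cons_eq, Nat.ofDigits_cons_eq, Nat.cast_id]
    by_cases h : a ≠ 0 ∨ Nat.ofDigits B L ≠ 0
    · rw [Nat.digits_add B hB _ _ ha h, Nat.ofDigits_cons_eq, ih']
    · push Not at h
      rw [h.2, Nat.digits_zero, Nat.ofDigits_nil_eq] at ih'
      simp [h.1, h.2, ← ih']

theorem Polynomial.exists_ofDigits_X_eq (n : ℕ) :
    ∀ G : ℕ[X], (∀ k, n ≤ k → G.coeff k = 0) → ∃ L : List ℕ, Nat.ofDigits X L = G := by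
  induction n with
  | zero => exact fun G hG => ⟨[], by ext k; simp [hG k (Nat.zero_le k)]⟩
  | succ n ih =>
    intro G hG
    obtain ⟨L, hL⟩ := ih G.divX fun k hk => by rw [coeff_divX]; exact hG _ (by omega)
    refine ⟨G.coeff 0 :: L, ?_⟩
    rw [Nat.ofDigits_cons_eq, hL, add_comm, X_mul]
    exact divX_mul_X_add G

theorem Nat.coeff_ofDigits_X {R : Type*} [Semiring R] (L : List ℕ) (k : ℕ) :
    (Nat.ofDigits (X : R[X]) L).coeff k = (L.getD k 0 : ℕ) := by
  induction L generalizing k with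
  | nil => simp
  | cons a L ih =>
    rw [Nat.ofDigits_cons_eq, coeff_add]
    cases k with
    | zero => simp
    | succ k => rw [coeff_X_mul, ih, coeff_natCast_ite]; simp

theorem Nat.eq_of_forall_div_pow_mod_eq {q x x' : ℕ} (hq : 1 < q)
    (h : ∀ k, x / q ^ k % q = x' / q ^ k % q) : x = x' := by
  have hmod : ∀ k, x % q ^ k = x' % q ^ k := by
    intro k
    induction k with
    | zero => simp [Nat.mod_one]
    | succ k ih => rw [Nat.mod_pow_succ, Nat.mod_pow_succ, ih, h]
  have := hmod (x + x')
  have hlt := Nat.lt_pow_self hq (n := x + x')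
  rwa [Nat.mod_eq_of_lt (by omega), Nat.mod_eq_of_lt (by omega)] at this

theorem Nat.mod_pow_div_pow_mod {q x s k : ℕ} (hk : k < s) :
    x % q ^ s / q ^ k % q = x / q ^ k % q := by
  obtain ⟨j, rfl⟩ : ∃ j, s = k + (j + 1) := ⟨s - k - 1, by omega⟩
  rw [pow_add, Nat.mod_mul_right_div_self, Nat.mod_mod_of_dvd _ (dvd_pow_self q (by omega))]

/-- The polynomial over `ZMod q` whose coefficients are the base-`q` digits of `x`. -/
noncomputable def digitPoly (q x : ℕ) : (ZMod q)[X] := Nat.ofDigits X (Nat.digits q x)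

variable {q : ℕ}

theorem coeff_digitPoly (hq : 1 < q) (x k : ℕ) :
    (digitPoly q x).coeff k = ((x / q ^ k % q : ℕ) : ZMod q) := by
  rw [digitPoly, Nat.coeff_ofDigits_X, Nat.getD_digits _ _ hq]

theorem coeff_digitPoly_eq_iff (hq : 1 < q) (x x' k k' : ℕ) :
    (digitPoly q x).coeff k = (digitPoly q x').coeff k' ↔ x / q ^ k % q = x' / q ^ k' % q := by
  rw [coeff_digitPoly hq, coeff_digitPoly hq, ZMod.natCast_eq_natCast_iff', Nat.mod_mod,
    Nat.mod_mod]

theorem digitPoly_injective (hq : 1 < q) : Function.Injective (digitPoly q) := fun x x' h =>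
  Nat.eq_of_forall_div_pow_mod_eq hq fun k => by
    rw [← coeff_digitPoly_eq_iff hq, h]

theorem coeff_digitPoly_mod (hq : 1 < q) (x : ℕ) {s k : ℕ} (hk : k < s) :
    (digitPoly q (x % q ^ s)).coeff k = (digitPoly q x).coeff k := by
  rw [coeff_digitPoly_eq_iff hq, Nat.mod_pow_div_pow_mod hk]

theorem coeff_digitPoly_eq_zero (hq : 1 < q) {x n k : ℕ} (hx : x < q ^ n) (hk : n ≤ k) :
    (digitPoly q x).coeff k = 0 := by
  rw [coeff_digitPoly hq, Nat.div_eq_of_lt (hx.trans_le (Nat.pow_le_pow_right (by omega) hk))]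
  simp

theorem lt_pow_of_natDegree_digitPoly_lt (hq : 1 < q) {x n : ℕ}
    (h : (digitPoly q x).natDegree < n) : x < q ^ n := by
  have : x = x % q ^ n := by
    apply digitPoly_injective hq
    ext k
    by_cases hk : k < n
    · rw [coeff_digitPoly_mod hq x hk]
    · rw [coeff_digitPoly_eq_zero hq (Nat.mod_lt _ (by positivity)) (by omega : n ≤ k),
        coeff_eq_zero_of_natDegree_lt (by omega)]
  rw [this]
  exact Nat.mod_lt _ (by positivity)

theorem natDegree_digitPoly_lt (hq : 1 < q) {x n : ℕ} (hn : 0 < n) (hx : x < q ^ n) :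
    (digitPoly q x).natDegree < n := by
  rw [Nat.lt_iff_le_pred hn, natDegree_le_iff_coeff_eq_zero]
  intro k hk
  exact coeff_digitPoly_eq_zero hq hx (by omega)

theorem digitPoly_ofDigits (hq : 1 < q) (L : List ℕ) (hL : ∀ a ∈ L, a < q) :
    digitPoly q (Nat.ofDigits q L) = Nat.ofDigits X L :=
  Nat.ofDigits_digits_ofDigits hq _ L hL

/-- The Taylor shift `f(X) ↦ f(X + y)` on polynomials over `ZMod q` encoded by base-`q` digits,
done by integer arithmetic: the integer value of `f(X + y)` at `X = B` is computed, its base-`B`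
digits are the coefficients, and these are reduced modulo `q`. -/
def numShift (q B y x : ℕ) : ℕ :=
  Nat.ofDigits q ((Nat.digits B (Nat.ofDigits (B + y) (Nat.digits q x))).map (· % q))

theorem digitPoly_numShift (hq : 1 < q) {B y x : ℕ} (hB : 1 < B)
    (hx : Nat.ofDigits (1 + y) (Nat.digits q x) < B) :
    digitPoly q (numShift q B y x) = taylor (y : ZMod q) (digitPoly q x) := by
  set G : ℕ[X] := Nat.ofDigits (X + C y) (Nat.digits q x) with hG
  obtain ⟨L, hL⟩ := exists_ofDigits_X_eq (G.natDegree + 1) G fun k hk =>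
    coeff_eq_zero_of_natDegree_lt (by omega)
  have hev : ∀ b : ℕ, Nat.ofDigits b L = Nat.ofDigits (b + y) (Nat.digits q x) := by
    intro b
    have h1 := congrArg (evalRingHom b) hL
    rw [hG, Nat.map_ofDigits_eq, Nat.map_ofDigits_eq] at h1
    simpa using h1
  have hlt : ∀ a ∈ L, a < B := by
    intro a ha
    refine lt_of_le_of_lt ?_ hx
    rw [← hev 1, Nat.ofDigits_one]
    exact List.le_sum_of_mem ha
  have hmod : ∀ L' : List ℕ, (Nat.ofDigits (X : (ZMod q)[X]) (L'.map (· % q)))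
      = Nat.ofDigits X L' := by
    intro L'
    induction L' with
    | nil => rfl
    | cons a L' ih =>
      rw [List.map_cons, Nat.ofDigits_cons_eq, Nat.ofDigits_cons_eq, ih]
      congr 1
      rw [← C_eq_natCast, ← C_eq_natCast, ZMod.natCast_mod]
  rw [numShift, digitPoly_ofDigits hq _ (fun a ha => by
    obtain ⟨b, _, rfl⟩ := List.mem_map.mp ha
    exact Nat.mod_lt _ (by omega)), hmod, ← hev B, Nat.ofDigits_digits_ofDigits hB _ L hlt]
  have h2 := congrArg (mapRingHom (Nat.castRingHom (ZMod q))) hL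
  rw [hG, Nat.map_ofDigits_eq, Nat.map_ofDigits_eq] at h2
  have h3 : taylor (y : ZMod q) (digitPoly q x)
      = Nat.ofDigits (X + C (y : ZMod q)) (Nat.digits q x) := by
    have := Nat.map_ofDigits_eq (taylorAlgHom (y : ZMod q) : (ZMod q)[X] →+* (ZMod q)[X]) X
      (Nat.digits q x)
    simpa [digitPoly] using this
  rw [h3]
  simpa using h2

theorem ofDigits_one_add_lt (hq : 1 < q) {n y x : ℕ} (hy : y ≤ q) (hx : x < q ^ n) :
    Nat.ofDigits (1 + y) (Nat.digits q x) < (q ^ n) ^ 2 + 1 := by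
  have h1 : Nat.ofDigits (1 + y) (Nat.digits q x) ≤ Nat.ofDigits (1 + q) (Nat.digits q x) :=
    Nat.ofDigits_monotone _ (by omega)
  have h2 : Nat.ofDigits (1 + q) (Nat.digits q x) < (1 + q) ^ (Nat.digits q x).length :=
    Nat.ofDigits_lt_base_pow_length (by omega) fun a ha =>
      (Nat.digits_lt_base hq ha).trans (by omega)
  have h3 : (Nat.digits q x).length ≤ n := (Nat.digits_length_le_iff hq x).mpr hx
  have h4 : (1 + q) ^ (Nat.digits q x).length ≤ (q ^ 2) ^ n :=
    (Nat.pow_le_pow_right (by omega) h3).trans (Nat.pow_le_pow_left (by nlinarith) n)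
  rw [← pow_mul, mul_comm, pow_mul] at h4
  omega

/-- The Taylor shift by `y` on encoded polynomials of degree below `n`. The evaluation point
`q ^ (2 * n) + 1` exceeds all integer coefficients that occur. -/
def vertexShift (q n y x : ℕ) : ℕ := numShift q ((q ^ n) ^ 2 + 1) y x

theorem digitPoly_vertexShift (hq : 1 < q) {n y x : ℕ} (hy : y ≤ q) (hx : x < q ^ n) :
    digitPoly q (vertexShift q n y x) = taylor (y : ZMod q) (digitPoly q x) :=
  digitPoly_numShift hq (by have : 0 < (q ^ n) ^ 2 := by positivity
                            omega) (ofDigits_one_add_lt hq hy hx)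

theorem vertexShift_lt (hq : 1 < q) {n y x : ℕ} (hn : 0 < n) (hy : y ≤ q) (hx : x < q ^ n) :
    vertexShift q n y x < q ^ n := by
  apply lt_pow_of_natDegree_digitPoly_lt hq
  rw [digitPoly_vertexShift hq hy hx, natDegree_taylor]
  exact natDegree_digitPoly_lt hq hn hx

theorem vertexShift_vertexShift (hq : 1 < q) {n y y' x : ℕ} (hn : 0 < n) (hy : y ≤ q)
    (hx : x < q ^ n) (hyy : y + y' = q) :
    vertexShift q n y' (vertexShift q n y x) = x := by
  apply digitPoly_injective hq
  rw [digitPoly_vertexShift hq (by omega) (vertexShift_lt hq hn hy hx),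
    digitPoly_vertexShift hq hy hx, taylor_taylor, ← Nat.cast_add, add_comm y', hyy]
  simp

end Digits

/-! ### The multiplicity code graph -/

section Graph

open Polynomial

theorem div_lt_pow_of_lt_pow_succ {q s w : ℕ} (hq : 1 < q) (hw : w < q ^ (s + 1)) :
    w / q < q ^ s := by
  rw [Nat.div_lt_iff_lt_mul (by omega)]
  simpa [pow_succ] using hw

theorem div_add_pow_mul_lt {q n s w j : ℕ} (hq : 1 < q) (hs : s ≤ n) (hw : w < q ^ (s + 1))
    (hj : j < q ^ (n - s)) : w / q + q ^ s * j < q ^ n := by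
  have h1 := div_lt_pow_of_lt_pow_succ hq hw
  calc w / q + q ^ s * j < q ^ s * (j + 1) := by rw [mul_add]; omega
    _ ≤ q ^ s * q ^ (n - s) := Nat.mul_le_mul_left _ hj
    _ = q ^ n := by rw [← pow_add, Nat.add_sub_cancel' hs]

/-- The multiplicity code graph over `ZMod q`. Left vertices are the polynomials of degree below
`n`, encoded by base-`q` digits. The neighbor of `f` with label `y` is the pair of `y` and of the
residue of `f(X + y)` modulo `X ^ s`, that is, the `s`-jet of `f` at `y`. A polynomial is recovered
from a right vertex and the quotient of `f(X + y)` by `X ^ s`, by shifting back. -/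
def multiplicityGraph (q n s : ℕ) (hq : 1 < q) (hn : 0 < n) (hs : s ≤ n) :
    BiregularGraph (q ^ n) q (q ^ (s + 1)) (q ^ (n - s)) where
  left x i := ⟨i + q * (vertexShift q n i x % q ^ s), by
    have h1 := Nat.mod_lt (vertexShift q n i x) (show 0 < q ^ s by positivity)
    have h2 := i.2
    calc (i : ℕ) + q * (vertexShift q n i x % q ^ s)
        < q * (vertexShift q n i x % q ^ s + 1) := by rw [mul_add]; omega
      _ ≤ q * q ^ s := Nat.mul_le_mul_left _ h1
      _ = q ^ (s + 1) := by ring⟩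
  right w j := ⟨vertexShift q n (q - w % q) (w / q + q ^ s * j),
    vertexShift_lt hq hn (Nat.sub_le _ _) (div_add_pow_mul_lt hq hs w.2 j.2)⟩
  left_injective x i i' h := by
    have := congrArg (fun z : Fin (q ^ (s + 1)) => (z : ℕ) % q) h
    simp only [Nat.add_mul_mod_self_left, Nat.mod_eq_of_lt i.2, Nat.mod_eq_of_lt i'.2] at this
    exact Fin.ext this
  right_injective w j j' h := by
    have hlt (k : Fin (q ^ (n - s))) := div_add_pow_mul_lt hq hs w.2 k.2
    have hy : q - (w : ℕ) % q + w % q = q := Nat.sub_add_cancel (Nat.mod_lt _ (by omega)).le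
    have h1 := congrArg (fun z : Fin (q ^ n) => vertexShift q n (w % q) z) h
    simp only [vertexShift_vertexShift hq hn (Nat.sub_le _ _) (hlt _) hy] at h1
    have h2 : q ^ s * (j : ℕ) = q ^ s * j' := by omega
    exact Fin.ext (Nat.eq_of_mul_eq_mul_left (by positivity) h2)
  edge_iff x w := by
    constructor
    · rintro ⟨i, rfl⟩
      have hlt := vertexShift_lt hq hn i.2.le x.2
      refine ⟨⟨vertexShift q n i x / q ^ s, ?_⟩, ?_⟩
      · rw [Nat.div_lt_iff_lt_mul (by positivity), ← pow_add, Nat.sub_add_cancel hs]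
        exact hlt
      · apply Fin.ext
        simp only [Nat.add_mul_mod_self_left, Nat.mod_eq_of_lt i.2]
        rw [Nat.add_mul_div_left _ _ (by omega), Nat.div_eq_of_lt i.2, zero_add, Nat.mod_add_div]
        exact vertexShift_vertexShift hq hn i.2.le x.2 (by have := i.2; omega)
    · rintro ⟨j, rfl⟩
      have h1 := div_lt_pow_of_lt_pow_succ hq w.2
      have hlt := div_add_pow_mul_lt hq hs w.2 j.2
      have hwq : (w : ℕ) % q < q := Nat.mod_lt _ (by omega)
      refine ⟨⟨w % q, hwq⟩, Fin.ext ?_⟩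
      simp only
      rw [vertexShift_vertexShift hq hn (Nat.sub_le _ _) hlt (Nat.sub_add_cancel hwq.le),
        Nat.add_mul_mod_self_left, Nat.mod_eq_of_lt h1, Nat.mod_add_div]

variable {q n s : ℕ} (hq : 1 < q) (hn : 0 < n) (hs : s ≤ n)

theorem left_multiplicityGraph_val (x : Fin (q ^ n)) (i : Fin q) :
    ((multiplicityGraph q n s hq hn hs).left x i : ℕ)
      = i + q * (vertexShift q n i x % q ^ s) := rfl

theorem coeff_digitPoly_left_div (x : Fin (q ^ n)) (i : Fin q) {k : ℕ} (hk : k < s) :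
    (digitPoly q (((multiplicityGraph q n s hq hn hs).left x i : ℕ) / q)).coeff k
      = (taylor ((i : ℕ) : ZMod q) (digitPoly q x)).coeff k := by
  rw [left_multiplicityGraph_val, Nat.add_mul_div_left _ _ (by omega), Nat.div_eq_of_lt i.2,
    zero_add, coeff_digitPoly_mod hq _ hk, digitPoly_vertexShift hq i.2.le x.2]

theorem left_multiplicityGraph_mod (x : Fin (q ^ n)) (i : Fin q) :
    ((multiplicityGraph q n s hq hn hs).left x i : ℕ) % q = i := by
  rw [left_multiplicityGraph_val, Nat.add_mul_mod_self_left, Nat.mod_eq_of_lt i.2]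

/-- The left expansion of the multiplicity code, transported to numbered vertices. -/
theorem mul_card_le_card_leftNbrs_multiplicityGraph {d : ℕ} (hp : q.Prime) (hnq : n ≤ q)
    (hdq : d ≤ q) (hdeg : (d - 1) * (1 + s * (n - 1)) < q) (S : Finset (Fin (q ^ n)))
    (hS : q * S.card < d ^ (s + 1)) :
    (q - (d - 1) * (1 + s * (n - 1))) * S.card
      ≤ ((multiplicityGraph q n s hq hn hs).leftNbrs S).card := by
  classical
  have := Fact.mk hp
  have hinj : Function.Injective fun x : Fin (q ^ n) => digitPoly q x :=
    (digitPoly_injective hq).comp Fin.val_injective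
  have key := mul_card_le_card_jetImage (F := ZMod q) (s := s) hnq hdq
    (by rwa [ZMod.card]) (S.image fun x : Fin (q ^ n) => digitPoly q x) (by
      intro f hf
      obtain ⟨x, _, rfl⟩ := Finset.mem_image.mp hf
      exact natDegree_digitPoly_lt hq hn x.2) (by
      rwa [ZMod.card, Finset.card_image_of_injective _ hinj])
  rw [ZMod.card, Finset.card_image_of_injective _ hinj] at key
  refine key.trans ?_
  -- the jet can be read off from the number of the right vertex
  refine le_trans (Finset.card_le_card (t := ((multiplicityGraph q n s hq hn hs).leftNbrs S).image
    fun w : Fin (q ^ (s + 1)) => (((w : ℕ) : ZMod q),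
      fun k : Fin s => (digitPoly q ((w : ℕ) / q)).coeff k)) ?_)
    Finset.card_image_le
  intro w hw
  obtain ⟨f, hf, a, rfl⟩ := mem_jetImage.mp hw
  obtain ⟨x, hx, rfl⟩ := Finset.mem_image.mp hf
  set i : Fin q := ⟨a.val, a.val_lt⟩ with hi
  refine Finset.mem_image.mpr ⟨(multiplicityGraph q n s hq hn hs).left x i, ?_, ?_⟩
  · exact Finset.mem_biUnion.mpr ⟨x, hx, Finset.mem_image_of_mem _ (Finset.mem_univ i)⟩
  · have hia : ((i : ℕ) : ZMod q) = a := by simp [hi]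
    refine Prod.ext ?_ (funext fun k => ?_)
    · simp only
      rw [← ZMod.natCast_mod, left_multiplicityGraph_mod, hia]
    · simp only
      rw [coeff_digitPoly_left_div hq hn hs x i k.2, hia, taylor_coeff, jet]

/-- The second Bonferroni inequality for sets of equal size with bounded pairwise intersections. -/
theorem Finset.two_mul_card_mul_le_card_biUnion {ι α : Type*} [DecidableEq ι] [DecidableEq α]
    (T : Finset ι) (A : ι → Finset α) {D B : ℕ} (hD : ∀ i ∈ T, (A i).card = D)
    (hB : ∀ i ∈ T, ∀ j ∈ T, i ≠ j → (A i ∩ A j).card ≤ B) :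
    2 * (D * T.card) ≤ 2 * (T.biUnion A).card + B * T.card ^ 2 := by
  induction T using Finset.induction_on with
  | empty => simp
  | insert a T ha ih =>
    have ih' := ih (fun i hi => hD i (Finset.mem_insert_of_mem hi)) fun i hi j hj =>
      hB i (Finset.mem_insert_of_mem hi) j (Finset.mem_insert_of_mem hj)
    rw [Finset.biUnion_insert, Finset.card_insert_of_notMem ha]
    have h1 := Finset.card_union_add_card_inter (A a) (T.biUnion A)
    rw [hD a (Finset.mem_insert_self a T)] at h1
    have h2 : (A a ∩ T.biUnion A).card ≤ T.card * B := by
      rw [Finset.inter_biUnion]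
      refine Finset.card_biUnion_le_card_mul _ _ _ fun i hi => ?_
      exact hB a (Finset.mem_insert_self a T) i (Finset.mem_insert_of_mem hi)
        fun h => ha (h ▸ hi)
    nlinarith

/-- Two right vertices have few common neighbors: at the same point they have none, and at distinct
points the common neighbors differ by multiples of a polynomial of degree `2 * s`. -/
theorem card_right_inter_le (hp : q.Prime) {w w' : Fin (q ^ (s + 1))} (hw : w ≠ w') :
    ((Finset.univ.image ((multiplicityGraph q n s hq hn hs).right w)) ∩
      (Finset.univ.image ((multiplicityGraph q n s hq hn hs).right w'))).card
      ≤ q ^ (n - 2 * s) := by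
  classical
  have := Fact.mk hp
  set G := multiplicityGraph q n s hq hn hs with hG
  set I := (Finset.univ.image (G.right w)) ∩ (Finset.univ.image (G.right w')) with hI
  rcases I.eq_empty_or_nonempty with h0 | ⟨x₀, hx₀⟩
  · simp [h0]
  have hmem : ∀ x ∈ I, ∃ i i', G.left x i = w ∧ G.left x i' = w' := by
    intro x hx
    rw [hI, Finset.mem_inter, Finset.mem_image, Finset.mem_image] at hx
    obtain ⟨⟨j, _, hj⟩, ⟨j', _, hj'⟩⟩ := hx
    obtain ⟨i, hi⟩ := (G.edge_iff x w).mpr ⟨j, hj⟩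
    obtain ⟨i', hi'⟩ := (G.edge_iff x w').mpr ⟨j', hj'⟩
    exact ⟨i, i', hi, hi'⟩
  obtain ⟨i, i', hi, hi'⟩ := hmem x₀ hx₀
  have hii : i ≠ i' := by
    rintro rfl
    exact hw (hi.symm.trans hi')
  have hdvd : ∀ (v : Fin (q ^ (s + 1))) (l : Fin q) (x : Fin (q ^ n)), G.left x₀ l = v →
      (∃ k, G.left x k = v) →
      (X - C ((l : ℕ) : ZMod q)) ^ s ∣ digitPoly q x - digitPoly q x₀ := by
    rintro v l x h0 ⟨k, hk⟩
    have hkl : k = l := by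
      apply Fin.ext
      rw [← left_multiplicityGraph_mod hq hn hs x k, ← left_multiplicityGraph_mod hq hn hs x₀ l,
        ← hG, hk, h0]
    subst hkl
    rw [X_sub_C_pow_dvd_iff_taylor_coeff]
    intro m hm
    rw [map_sub, coeff_sub, ← coeff_digitPoly_left_div hq hn hs x k hm,
      ← coeff_digitPoly_left_div hq hn hs x₀ k hm, ← hG, hk, h0, sub_self]
  set P : (ZMod q)[X] := (X - C ((i : ℕ) : ZMod q)) ^ s * (X - C ((i' : ℕ) : ZMod q)) ^ s with hP
  have hne : ((i : ℕ) : ZMod q) ≠ ((i' : ℕ) : ZMod q) := by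
    rw [Ne, ZMod.natCast_eq_natCast_iff', Nat.mod_eq_of_lt i.2, Nat.mod_eq_of_lt i'.2]
    exact fun h => hii (Fin.ext h)
  have hPdvd : ∀ x ∈ I, P ∣ digitPoly q x - digitPoly q x₀ := by
    intro x hx
    obtain ⟨k, k', hk, hk'⟩ := hmem x hx
    refine IsCoprime.mul_dvd ?_ (hdvd w i x hi ⟨k, hk⟩) (hdvd w' i' x hi' ⟨k', hk'⟩)
    exact (isCoprime_X_sub_C_of_isUnit_sub (sub_ne_zero.mpr hne).isUnit).pow
  choose! g hg using hPdvd
  have hP0 : P ≠ 0 := mul_ne_zero (pow_ne_zero _ (X_sub_C_ne_zero _))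
    (pow_ne_zero _ (X_sub_C_ne_zero _))
  have hPdeg : P.natDegree = 2 * s := by
    rw [hP, natDegree_mul (pow_ne_zero _ (X_sub_C_ne_zero _)) (pow_ne_zero _ (X_sub_C_ne_zero _)),
      natDegree_pow, natDegree_pow, natDegree_X_sub_C, natDegree_X_sub_C]
    ring
  have hgdeg : ∀ x ∈ I, ∀ k, n - 2 * s ≤ k → (g x).coeff k = 0 := by
    intro x hx k hk
    by_cases h0 : g x = 0
    · simp [h0]
    apply coeff_eq_zero_of_natDegree_lt
    have h1 := congrArg natDegree (hg x hx)
    rw [natDegree_mul hP0 h0, hPdeg] at h1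
    have h2 := natDegree_sub_le (digitPoly q x) (digitPoly q x₀)
    have h3 : max (digitPoly q x).natDegree (digitPoly q x₀).natDegree < n :=
      max_lt (natDegree_digitPoly_lt hq hn x.2) (natDegree_digitPoly_lt hq hn x₀.2)
    omega
  have hcard : (Finset.univ : Finset (Fin (n - 2 * s) → ZMod q)).card = q ^ (n - 2 * s) := by
    simp
  rw [← hcard]
  refine Finset.card_le_card_of_injOn (fun x k => (g x).coeff k) (fun _ _ => Finset.mem_univ _) ?_
  intro x hx x' hx' h
  have hgg : g x = g x' := by
    ext k
    by_cases hk : k < n - 2 * s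
    · exact congrFun h ⟨k, hk⟩
    · rw [hgdeg x hx k (by omega), hgdeg x' hx' k (by omega)]
  have := hg x hx
  rw [hgg, ← hg x' hx', sub_left_inj] at this
  exact Fin.ext (digitPoly_injective hq this)

theorem two_mul_card_mul_le_card_rightNbrs (hp : q.Prime) (T : Finset (Fin (q ^ (s + 1)))) :
    2 * (q ^ (n - s) * T.card) ≤ 2 * ((multiplicityGraph q n s hq hn hs).rightNbrs T).card
      + q ^ (n - 2 * s) * T.card ^ 2 := by
  classical
  refine Finset.two_mul_card_mul_le_card_biUnion T _ (fun w _ => ?_) fun w _ w' _ h =>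
    card_right_inter_le hq hn hs hp h
  rw [Finset.card_image_of_injective _ ((multiplicityGraph q n s hq hn hs).right_injective w)]
  simp

end Graph

/-! ### Running times of programs -/

section Machine

/-- `p` takes the register contents `σ` to `σ'` in time at most `k * (L + 1) ^ 2`. This is the form
of a time bound for about `k` instructions on numbers below `2 ^ L`. -/
def Exec (p : Prog) (σ σ' : ℕ → ℕ) (L k : ℕ) : Prop :=
  ∃ t, Run p σ σ' t ∧ t ≤ k * (L + 1) ^ 2

/-- The registers that a program may write to. -/
def Prog.writes : Prog → List ℕ
  | .const r _ => [r]
  | .arith _ r _ _ => [r]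
  | .seq p q => p.writes ++ q.writes
  | .cond _ p q => p.writes ++ q.writes
  | .loop _ p => p.writes

theorem Run.eq_of_notMem_writes {p : Prog} {σ σ' : ℕ → ℕ} {t : ℕ} (h : Run p σ σ' t) {r : ℕ}
    (hr : r ∉ p.writes) : σ' r = σ r := by
  induction h with
  | const => exact Function.update_of_ne (by simpa [Prog.writes] using hr) _ _
  | arith => exact Function.update_of_ne (by simpa [Prog.writes] using hr) _ _
  | seq _ _ ih₁ ih₂ =>
    simp only [Prog.writes, List.mem_append, not_or] at hr
    rw [ih₂ hr.2, ih₁ hr.1]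
  | condTrue _ _ ih =>
    simp only [Prog.writes, List.mem_append, not_or] at hr
    exact ih hr.1
  | condFalse _ _ ih =>
    simp only [Prog.writes, List.mem_append, not_or] at hr
    exact ih hr.2
  | loopStep _ _ _ ih₁ ih₂ => rw [ih₂ hr, ih₁ hr]
  | loopExit => rfl

namespace Exec

variable {p p' : Prog} {σ σ₁ σ' : ℕ → ℕ} {L k k' r c a b : ℕ} {op : ArithOp}

theorem frame (h : Exec p σ σ' L k) (hr : r ∉ p.writes) : σ' r = σ r :=
  let ⟨_, ht, _⟩ := h
  ht.eq_of_notMem_writes hr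

theorem mono (h : Exec p σ σ' L k) (hk : k ≤ k') : Exec p σ σ' L k' :=
  let ⟨t, ht, htk⟩ := h
  ⟨t, ht, htk.trans (Nat.mul_le_mul_right _ hk)⟩

theorem const (hc : c < 2 ^ L) : Exec (.const r c) σ (Function.update σ r c) L 1 :=
  ⟨_, .const r c σ, by have := Nat.size_le.mpr hc; nlinarith⟩

theorem arith (ha : σ a < 2 ^ L) (hb : σ b < 2 ^ L) :
    Exec (.arith op r a b) σ (Function.update σ r (op.eval (σ a) (σ b))) L 1 :=
  ⟨_, .arith op r a b σ, by
    rw [one_mul, sq]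
    have := Nat.size_le.mpr ha
    have := Nat.size_le.mpr hb
    exact Nat.mul_le_mul (by omega) (by omega)⟩

theorem seq (h : Exec p σ σ₁ L k) (h' : Exec p' σ₁ σ' L k') :
    Exec (.seq p p') σ σ' L (k + k') :=
  let ⟨_, ht, htk⟩ := h
  let ⟨_, ht', htk'⟩ := h'
  ⟨_, .seq ht ht', by rw [add_mul]; exact add_le_add htk htk'⟩

theorem const_seq (hc : c < 2 ^ L) (h : Exec p (Function.update σ r c) σ' L k) :
    Exec (.seq (.const r c) p) σ σ' L (1 + k) :=
  seq (const hc) h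

theorem arith_seq (ha : σ a < 2 ^ L) (hb : σ b < 2 ^ L)
    (h : Exec p (Function.update σ r (op.eval (σ a) (σ b))) σ' L k) :
    Exec (.seq (.arith op r a b) p) σ σ' L (1 + k) :=
  seq (arith ha hb) h

theorem loop_exit (hr : σ r = 0) : Exec (.loop r p) σ σ L 1 :=
  ⟨_, .loopExit hr, by rw [hr]; simpa using Nat.one_le_pow 2 (L + 1) (by omega)⟩

theorem loop_step (hr : σ r ≠ 0) (hrL : σ r < 2 ^ L) (h : Exec p σ σ₁ L k)
    (h' : Exec (.loop r p) σ₁ σ' L k') : Exec (.loop r p) σ σ' L (k + 1 + k') :=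
  let ⟨_, ht, htk⟩ := h
  let ⟨_, ht', htk'⟩ := h'
  ⟨_, .loopStep hr ht ht', by
    have := Nat.size_le.mpr hrL
    nlinarith⟩

/-- A loop that runs `m` times, with an invariant indexed by the number of completed rounds. -/
theorem loop (I : ℕ → (ℕ → ℕ) → Prop) (m : ℕ)
    (hstep : ∀ i < m, ∀ σ, I i σ → σ r ≠ 0 ∧ σ r < 2 ^ L ∧ ∃ σ', Exec p σ σ' L k ∧ I (i + 1) σ')
    (hexit : ∀ σ, I m σ → σ r = 0) (h0 : I 0 σ) :
    ∃ σ', Exec (.loop r p) σ σ' L (m * (k + 1) + 1) ∧ I m σ' := by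
  have key : ∀ j, ∀ i, i + j = m → ∀ σ, I i σ →
      ∃ σ', Exec (.loop r p) σ σ' L (j * (k + 1) + 1) ∧ I m σ' := by
    intro j
    induction j with
    | zero =>
      rintro i rfl σ hI
      exact ⟨σ, by simpa using loop_exit (hexit σ hI), hI⟩
    | succ j ih =>
      intro i hij σ hI
      obtain ⟨h1, h2, σ₁, h3, h4⟩ := hstep i (by omega) σ hI
      obtain ⟨σ', h5, h6⟩ := ih (i + 1) (by omega) σ₁ h4
      exact ⟨σ', (loop_step h1 h2 h3 h5).mono (by rw [add_mul]; omega), h6⟩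
  exact key m 0 (by omega) σ h0

end Exec

/-- Copy register `a` to register `r ≠ a`. -/
def Prog.move (r a : ℕ) : Prog := .seq (.const r 0) (.arith .add r r a)

theorem Exec.move {σ : ℕ → ℕ} {L r a : ℕ} (hra : a ≠ r) (ha : σ a < 2 ^ L) :
    Exec (.move r a) σ (Function.update σ r (σ a)) L 2 := by
  have h := Exec.const_seq (σ := σ) (r := r) (c := 0) (L := L) (by positivity)
    (Exec.arith (op := .add) (r := r) (a := r) (b := a) (by simp) (by simpa [hra] using ha))
  simpa [Prog.move, ArithOp.eval, hra] using h

theorem Exec.move_seq {σ σ' : ℕ → ℕ} {L r a k : ℕ} {p : Prog} (hra : a ≠ r) (ha : σ a < 2 ^ L)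
    (h : Exec p (Function.update σ r (σ a)) σ' L k) :
    Exec (.seq (.move r a) p) σ σ' L (2 + k) :=
  Exec.seq (Exec.move hra ha) h

/-! ### The programs -/

/-- Write the power of register `41` with the exponent in register `42` into register `40`. -/
def powProg : Prog :=
  .seq (.const 40 1) (.seq (.const 43 1)
    (.loop 42 (.seq (.arith .mul 40 40 41) (.arith .sub 42 42 43))))

theorem exec_powProg {σ : ℕ → ℕ} {L b e : ℕ} (hb : σ 41 = b) (he : σ 42 = e) (hb0 : 0 < b)
    (hL : 0 < L) (hbL : b < 2 ^ L) (heL : e < 2 ^ L) (hbe : b ^ e < 2 ^ L) :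
    ∃ σ', Exec powProg σ σ' L (3 * e + 3) ∧ σ' 40 = b ^ e := by
  have h1L : 1 < 2 ^ L := Nat.one_lt_two_pow (by omega)
  have hpow : ∀ i ≤ e, b ^ i < 2 ^ L := fun i hi =>
    (Nat.pow_le_pow_right hb0 hi).trans_lt hbe
  obtain ⟨σ', h, hI⟩ := Exec.loop (r := 42) (L := L) (k := 2)
    (p := .seq (.arith .mul 40 40 41) (.arith .sub 42 42 43))
    (σ := Function.update (Function.update σ 40 1) 43 1)
    (fun i τ => τ 40 = b ^ i ∧ τ 41 = b ∧ τ 42 = e - i ∧ τ 43 = 1) e (by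
      rintro i hi τ ⟨h40, h41, h42, h43⟩
      refine ⟨by omega, by omega, _, .arith_seq ?_ ?_ (.arith ?_ ?_), ?_⟩
      · rw [h40]; exact hpow i hi.le
      · rwa [h41]
      · simp; omega
      · simp; omega
      · simp [ArithOp.eval, h40, h41, h42, h43, pow_succ]
        omega) (by rintro τ ⟨_, _, h, _⟩; omega) (by simp [hb, he])
  exact ⟨σ', (Exec.const_seq h1L (Exec.const_seq h1L h)).mono (by omega), hI.1⟩

/-- Increase register `10` to the next larger prime. For each candidate the inner loop finds the
smallest divisor above `1`, and the candidate is prime if this divisor is the candidate itself. -/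
def nextPrimeProg : Prog :=
  .seq (.const 6 1) (.seq (.const 7 1) (.loop 7
    (.seq (.arith .add 10 10 6) (.seq (.const 8 2) (.seq (.arith .mod 9 10 8) (.seq
      (.loop 9 (.seq (.arith .add 8 8 6) (.arith .mod 9 10 8)))
      (.arith .sub 7 10 8)))))))

theorem exec_minFac_loop {τ : ℕ → ℕ} {L x : ℕ} (hx : 2 ≤ x) (hxL : x < 2 ^ L) (h6 : τ 6 = 1)
    (h8 : τ 8 = 2) (h9 : τ 9 = x % 2) (h10 : τ 10 = x) :
    ∃ τ', Exec (.loop 9 (.seq (.arith .add 8 8 6) (.arith .mod 9 10 8))) τ τ' L (3 * x + 1) ∧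
      τ' 8 = x.minFac := by
  have hmf : 2 ≤ x.minFac := (Nat.minFac_prime (by omega)).two_le
  have hle : x.minFac ≤ x := Nat.minFac_le (by omega)
  obtain ⟨τ', h, hI⟩ := Exec.loop (r := 9) (L := L) (k := 2)
    (p := .seq (.arith .add 8 8 6) (.arith .mod 9 10 8)) (σ := τ)
    (fun i τ => τ 6 = 1 ∧ τ 8 = 2 + i ∧ τ 9 = x % (2 + i) ∧ τ 10 = x) (x.minFac - 2) (by
      rintro i hi τ ⟨h6, h8, h9, h10⟩
      refine ⟨?_, ?_, _, .arith_seq ?_ ?_ (.arith ?_ ?_), ?_⟩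
      · rw [h9]
        intro h0
        have := Nat.minFac_le_of_dvd (by omega) (Nat.dvd_of_mod_eq_zero h0)
        omega
      · rw [h9]
        have := Nat.mod_lt x (show 0 < 2 + i by omega)
        omega
      · omega
      · omega
      · simpa [h10] using hxL
      · simp [ArithOp.eval, h8, h6]; omega
      · simp [ArithOp.eval, h6, h8, h10, add_assoc]) (by
      rintro τ ⟨_, _, h, _⟩
      rw [h, Nat.add_sub_cancel' hmf]
      exact Nat.mod_eq_zero_of_dvd (Nat.minFac_dvd x)) ⟨h6, h8, h9, h10⟩
  exact ⟨τ', h.mono (by omega), by rw [hI.2.1]; omega⟩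

theorem exec_nextPrimeProg {σ : ℕ → ℕ} {L a q : ℕ} (ha : 2 ≤ a) (h10 : σ 10 = a) (haq : a < q)
    (hq : q.Prime) (hmin : ∀ x, a < x → x < q → ¬ x.Prime) (hqL : q < 2 ^ L) :
    ∃ σ', Exec nextPrimeProg σ σ' L ((q - a) * (3 * q + 6) + 3) ∧ σ' 10 = q := by
  have h2L : 2 < 2 ^ L := by omega
  obtain ⟨σ', h, hI⟩ := Exec.loop (r := 7) (L := L) (k := 3 * q + 5)
    (p := .seq (.arith .add 10 10 6) (.seq (.const 8 2) (.seq (.arith .mod 9 10 8) (.seq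
      (.loop 9 (.seq (.arith .add 8 8 6) (.arith .mod 9 10 8)))
      (.arith .sub 7 10 8)))))
    (σ := Function.update (Function.update σ 6 1) 7 1)
    (fun i τ => τ 6 = 1 ∧ τ 10 = a + i ∧ (τ 7 = 0 ↔ i = q - a) ∧ τ 7 ≤ q) (q - a) (by
      rintro i hi τ ⟨h6, h10, h7, h7q⟩
      refine ⟨by omega, by omega, ?_⟩
      set x := a + i + 1 with hx
      have hxL : x < 2 ^ L := by omega
      set τ₁ := Function.update (Function.update (Function.update τ 10 x) 8 2) 9 (x % 2) with hτ₁
      obtain ⟨τ₂, he, h8⟩ := exec_minFac_loop (τ := τ₁) (L := L) (x := x) (by omega) hxL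
        (by simp [hτ₁, h6]) (by simp [hτ₁]) (by simp [hτ₁]) (by simp [hτ₁])
      have h6' : τ₂ 6 = 1 := by rw [he.frame (by decide)]; simp [hτ₁, h6]
      have h10' : τ₂ 10 = x := by rw [he.frame (by decide)]; simp [hτ₁]
      have hmle : x.minFac ≤ x := Nat.minFac_le (by omega)
      have hmp : x.Prime ↔ x.minFac = x := by
        rw [Nat.prime_def_minFac]
        exact ⟨fun h => h.2, fun h => ⟨by omega, h⟩⟩
      have hxq : x.Prime ↔ x = q :=
        ⟨fun h => by by_contra hne; exact hmin x (by omega) (by omega) h, fun h => h ▸ hq⟩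
      refine ⟨Function.update τ₂ 7 (x - x.minFac), ?_, ?_⟩
      · have e1 : ArithOp.add.eval (τ 10) (τ 6) = x := by simp [ArithOp.eval, h10, h6, hx]
        have key := Exec.arith_seq (op := .add) (r := 10) (a := 10) (b := 6) (σ := τ) (L := L)
          (by omega) (by omega) (.const_seq (r := 8) (c := 2) h2L
          (.arith_seq (op := .mod) (r := 9) (a := 10) (b := 8) (by simpa [e1] using hxL)
            (by simpa using h2L) (.seq (by simpa [ArithOp.eval, h10, h6, ← hx, ← hτ₁] using he)
            (.arith (op := .sub) (r := 7) (a := 10) (b := 8) (by omega) (by omega)))))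
        simp only [ArithOp.eval, h10', h8] at key
        exact key.mono (by omega)
      · refine ⟨by simp [h6'], by simp [h10', hx, add_assoc], ?_, ?_⟩
        · simp only [Function.update_self]
          rw [show x - x.minFac = 0 ↔ x.minFac = x by omega, ← hmp, hxq]
          omega
        · simp only [Function.update_self]
          omega) (by rintro τ ⟨_, _, h, _⟩; exact h.mpr rfl)
    (by simp [h10]; omega)
  refine ⟨σ', (Exec.const_seq (by omega) (Exec.const_seq (by omega) h)).mono ?_, by
    rw [hI.2.1]; omega⟩
  exact le_of_eq (by ring)

/-- With `P`, `q ^ 100` and `q` in the registers `13`, `14` and `10`, write into register `12` the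
least power `q ^ m` with `P ≤ q ^ (100 * m)`. -/
def rightSizeLoop : Prog :=
  .seq (.const 15 1) (.seq (.const 12 1) (.seq (.arith .sub 16 13 15)
    (.loop 16 (.seq (.arith .mul 15 15 14) (.seq (.arith .mul 12 12 10)
      (.arith .sub 16 13 15))))))

theorem exec_rightSizeLoop {σ : ℕ → ℕ} {L P q m : ℕ} (hq : 1 < q) (h10 : σ 10 = q)
    (h13 : σ 13 = P) (h14 : σ 14 = q ^ 100) (hm : P ≤ q ^ (100 * m))
    (hmin : ∀ i < m, q ^ (100 * i) < P) (hPL : P < 2 ^ L) (hqL : q ^ 100 < 2 ^ L)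
    (hmL : q ^ (100 * m) < 2 ^ L) :
    ∃ σ', Exec rightSizeLoop σ σ' L (4 * m + 4) ∧ σ' 12 = q ^ m := by
  have hqL' : q < 2 ^ L := (Nat.le_self_pow (by omega) q).trans_lt hqL
  have h1L : 1 < 2 ^ L := by omega
  have hpow : ∀ i ≤ m, q ^ (100 * i) < 2 ^ L := fun i hi =>
    (Nat.pow_le_pow_right (by omega) (by omega)).trans_lt hmL
  have hpow' : ∀ i ≤ m, q ^ i < 2 ^ L := fun i hi =>
    (Nat.pow_le_pow_right (by omega) (by omega)).trans_lt (hpow i hi)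
  obtain ⟨σ', h, hI⟩ := Exec.loop (r := 16) (L := L) (k := 3)
    (p := .seq (.arith .mul 15 15 14) (.seq (.arith .mul 12 12 10) (.arith .sub 16 13 15)))
    (σ := Function.update (Function.update (Function.update σ 15 1) 12 1) 16 (P - 1))
    (fun i τ => τ 10 = q ∧ τ 13 = P ∧ τ 14 = q ^ 100 ∧ τ 15 = q ^ (100 * i) ∧ τ 12 = q ^ i ∧
      τ 16 = P - q ^ (100 * i)) m (by
      rintro i hi τ ⟨h10, h13, h14, h15, h12, h16⟩
      have h1 := hmin i hi
      refine ⟨by omega, by omega, _, .arith_seq ?_ ?_ (.arith_seq ?_ ?_ (.arith ?_ ?_)), ?_⟩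
      · rw [h15]; exact hpow i hi.le
      · rwa [h14]
      · simp [h12]; exact hpow' i hi.le
      · simpa [h10]
      · simpa [h13]
      · simp [ArithOp.eval, h15, h14, ← pow_add]
        exact hpow (i + 1) hi
      · have e : q ^ (100 * i) * q ^ 100 = q ^ (100 * (i + 1)) := by rw [← pow_add]; ring
        simp [ArithOp.eval, h10, h13, h14, h15, h12, e, pow_succ q i])
    (by rintro τ ⟨_, _, _, _, _, h⟩; omega) (by simp [h10, h13, h14])
  refine ⟨σ', (Exec.const_seq h1L (Exec.const_seq h1L (Exec.arith_seq ?_ ?_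
    (by simpa [ArithOp.eval, h13] using h)))).mono (by omega), hI.2.2.2.2.1⟩
  · simpa [h13]
  · rw [Function.update_of_ne (by decide), Function.update_self]
    exact h1L

/-- Evaluate at register `23` the polynomial whose coefficients are the digits of register `20` to
the base in register `10`. -/
def evalDigitsLoop : Prog :=
  .loop 20 (.seq (.arith .mod 26 20 10) (.seq (.arith .mul 26 26 25) (.seq (.arith .add 24 24 26)
    (.seq (.arith .mul 25 25 23) (.arith .div 20 20 10)))))

theorem exec_evalDigitsLoop {L q β : ℕ} (hq : 1 < q) (hqL : q < 2 ^ L) (hβ : 0 < β)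
    (hβL : β < 2 ^ L) :
    ∀ (x : ℕ) (σ : ℕ → ℕ), σ 20 = x → σ 10 = q → σ 23 = β → x < 2 ^ L →
      σ 25 * β ^ (Nat.digits q x).length < 2 ^ L →
      σ 24 + σ 25 * Nat.ofDigits β (Nat.digits q x) < 2 ^ L →
      ∃ σ', Exec evalDigitsLoop σ σ' L (6 * (Nat.digits q x).length + 1) ∧
        σ' 24 = σ 24 + σ 25 * Nat.ofDigits β (Nat.digits q x) := by
  intro x
  induction x using Nat.strong_induction_on with
  | _ x ih =>
    intro σ h20 h10 h23 hxL hPL hRL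
    rcases Nat.eq_zero_or_pos x with rfl | hx
    · exact ⟨σ, by simpa using! Exec.loop_exit h20, by simp⟩
    have hdig := Nat.digits_def' hq hx
    rw [hdig, List.length_cons] at hPL
    rw [hdig, Nat.ofDigits_cons] at hRL
    set P := σ 25
    set R := σ 24
    set d := x % q with hd
    have hP : P < 2 ^ L := lt_of_le_of_lt (Nat.le_mul_of_pos_right _ (by positivity)) hPL
    have hdL : d < 2 ^ L := (Nat.mod_lt x (by omega)).trans hqL
    set len := (q.digits (x / q)).length
    have e : R + P * (d + β * Nat.ofDigits β (q.digits (x / q)))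
        = R + d * P + P * β * Nat.ofDigits β (q.digits (x / q)) := by ring
    rw [e] at hRL
    have hdPL : d * P < 2 ^ L := by omega
    obtain ⟨σ', h, hI⟩ := ih (x / q) (Nat.div_lt_self hx hq)
      (Function.update (Function.update (Function.update (Function.update
        (Function.update σ 26 d) 26 (d * P)) 24 (R + d * P)) 25 (P * β)) 20 (x / q))
      (by simp) (by simp [h10]) (by simp [h23]) ((Nat.div_le_self _ _).trans_lt hxL)
      (by simpa [pow_succ, mul_assoc, mul_comm β] using hPL) (by simpa using hRL)
    refine ⟨σ', ?_, ?_⟩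
    · refine (Exec.loop_step (k := 5) (σ₁ := Function.update (Function.update (Function.update
        (Function.update (Function.update σ 26 d) 26 (d * P)) 24 (R + d * P)) 25 (P * β)) 20
        (x / q)) (by omega) (by omega) ?_ h).mono (by rw [hdig, List.length_cons]; omega)
      have key := Exec.arith_seq (op := .mod) (r := 26) (a := 20) (b := 10) (σ := σ) (L := L)
        (by omega) (by omega) (.arith_seq (op := .mul) (r := 26) (a := 26) (b := 25)
          (by simpa [ArithOp.eval, h20, h10] using hdL) (by simpa using hP)
        (.arith_seq (op := .add) (r := 24) (a := 24) (b := 26)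
          (by simp; omega) (by simp [ArithOp.eval, h20, h10]; exact hdPL)
        (.arith_seq (op := .mul) (r := 25) (a := 25) (b := 23)
          (by simpa using hP) (by simpa [h23] using hβL)
        (.arith (op := .div) (r := 20) (a := 20) (b := 10)
          (by simpa [h20] using hxL) (by simpa [h10] using hqL)))))
      simpa [ArithOp.eval, h20, h10, h23] using key
    · rw [hI, hdig, Nat.ofDigits_cons]
      rw [e]
      simp

/-- Read the digits of register `24` to the base in register `22`, reduce them modulo register
`10`, and compose the number with these digits to the base in register `10`. -/
def reduceDigitsLoop : Prog :=
  .loop 24 (.seq (.arith .mod 26 24 22) (.seq (.arith .mod 26 26 10) (.seq (.arith .mul 26 26 27)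
    (.seq (.arith .add 28 28 26) (.seq (.arith .mul 27 27 10) (.arith .div 24 24 22))))))

theorem exec_reduceDigitsLoop {L q B : ℕ} (hq : 1 < q) (hqL : q < 2 ^ L) (hB : 1 < B)
    (hBL : B < 2 ^ L) :
    ∀ (x : ℕ) (σ : ℕ → ℕ), σ 24 = x → σ 10 = q → σ 22 = B → x < 2 ^ L →
      σ 27 * q ^ (Nat.digits B x).length < 2 ^ L →
      σ 28 + σ 27 * Nat.ofDigits q ((Nat.digits B x).map (· % q)) < 2 ^ L →
      ∃ σ', Exec reduceDigitsLoop σ σ' L (7 * (Nat.digits B x).length + 1) ∧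
        σ' 28 = σ 28 + σ 27 * Nat.ofDigits q ((Nat.digits B x).map (· % q)) := by
  intro x
  induction x using Nat.strong_induction_on with
  | _ x ih =>
    intro σ h24 h10 h22 hxL hPL hRL
    rcases Nat.eq_zero_or_pos x with rfl | hx
    · exact ⟨σ, by simpa using! Exec.loop_exit h24, by simp⟩
    have hdig := Nat.digits_def' hB hx
    rw [hdig, List.length_cons] at hPL
    rw [hdig, List.map_cons, Nat.ofDigits_cons] at hRL
    set P := σ 27
    set R := σ 28
    set d := x % B % q with hd
    have hP : P < 2 ^ L := lt_of_le_of_lt (Nat.le_mul_of_pos_right _ (by positivity)) hPL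
    have hdL : d < 2 ^ L := (Nat.mod_lt _ (by omega)).trans hqL
    have hdL' : x % B < 2 ^ L := (Nat.mod_lt _ (by omega)).trans hBL
    set ds := (B.digits (x / B)).map (· % q) with hds
    have e : R + P * (d + q * Nat.ofDigits q ds) = R + d * P + P * q * Nat.ofDigits q ds := by ring
    rw [e] at hRL
    have hdPL : d * P < 2 ^ L := by omega
    set σ₁ := Function.update (Function.update (Function.update (Function.update (Function.update
        (Function.update σ 26 (x % B)) 26 d) 26 (d * P)) 28 (R + d * P)) 27 (P * q)) 24 (x / B)
      with hσ₁
    obtain ⟨σ', h, hI⟩ := ih (x / B) (Nat.div_lt_self hx hB) σ₁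
      (by simp [hσ₁]) (by simp [hσ₁, h10]) (by simp [hσ₁, h22])
      ((Nat.div_le_self _ _).trans_lt hxL)
      (by simpa [hσ₁, pow_succ, mul_assoc, mul_comm q] using hPL)
      (by simpa [hσ₁, ← hds] using hRL)
    refine ⟨σ', ?_, ?_⟩
    · refine (Exec.loop_step (k := 6) (σ₁ := σ₁) (by omega) (by omega) ?_ h).mono
        (by rw [hdig, List.length_cons]; omega)
      have key := Exec.arith_seq (op := .mod) (r := 26) (a := 24) (b := 22) (σ := σ) (L := L)
        (by omega) (by omega) (.arith_seq (op := .mod) (r := 26) (a := 26) (b := 10)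
          (by simpa [ArithOp.eval, h24, h22] using hdL') (by simpa [h10] using hqL)
        (.arith_seq (op := .mul) (r := 26) (a := 26) (b := 27)
          (by simpa [ArithOp.eval, h24, h22, h10] using hdL) (by simpa using hP)
        (.arith_seq (op := .add) (r := 28) (a := 28) (b := 26)
          (by simp; omega) (by simp [ArithOp.eval, h24, h22, h10]; exact hdPL)
        (.arith_seq (op := .mul) (r := 27) (a := 27) (b := 10)
          (by simpa using hP) (by simpa [h10] using hqL)
        (.arith (op := .div) (r := 24) (a := 24) (b := 22)
          (by simpa [h24] using hxL) (by simpa [h22] using hBL))))))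
      simpa [ArithOp.eval, h24, h10, h22, hσ₁, hd, P, R] using key
    · rw [hI, hdig, List.map_cons, Nat.ofDigits_cons]
      rw [e]
      simp [hσ₁, ← hds]

end Machine

/-! ### The programs of the multiplicity code graph -/

section Programs

/-- Write the least prime above `(n + 2) ^ e` into register `10`, where `n` is in register `0`. -/
def fieldSizeProg (e : ℕ) : Prog :=
  .seq (.const 5 2) (.seq (.arith .add 41 0 5) (.seq (.const 42 e) (.seq powProg
    (.seq (.move 10 40) nextPrimeProg))))

theorem exec_fieldSizeProg {σ : ℕ → ℕ} {L n e q : ℕ} (h0 : σ 0 = n) (he : 0 < e) (heL : e < 2 ^ L)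
    (haq : (n + 2) ^ e < q) (hq : q.Prime)
    (hmin : ∀ x, (n + 2) ^ e < x → x < q → ¬ x.Prime) (hqL : q < 2 ^ L) :
    ∃ σ', Exec (fieldSizeProg e) σ σ' L (q * (3 * q + 6) + 3 * e + 11) ∧ σ' 10 = q := by
  have hne : n + 2 ≤ (n + 2) ^ e := Nat.le_self_pow (by omega) _
  have hL : 0 < L := by
    rcases Nat.eq_zero_or_pos L with rfl | h
    · omega
    · exact h
  set σ₁ := Function.update (Function.update (Function.update σ 5 2) 41 (n + 2)) 42 e with hσ₁
  obtain ⟨σ₂, h₂, h40⟩ := exec_powProg (σ := σ₁) (L := L) (b := n + 2) (e := e) (by simp [hσ₁])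
    (by simp [hσ₁]) (by omega) hL (by omega) heL (by omega)
  obtain ⟨σ₃, h₃, h10⟩ := exec_nextPrimeProg (σ := Function.update σ₂ 10 ((n + 2) ^ e)) (L := L)
    (a := (n + 2) ^ e) (by omega) (by simp) haq hq hmin hqL
  refine ⟨σ₃, ?_, h10⟩
  have key := Exec.const_seq (σ := σ) (r := 5) (c := 2) (L := L) (by omega)
    (.arith_seq (op := .add) (r := 41) (a := 0) (b := 5) (by simp; omega) (by simp; omega)
    (.const_seq (r := 42) (c := e) heL (.seq (by simpa [ArithOp.eval, h0, ← hσ₁] using h₂)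
    (.move_seq (r := 10) (a := 40) (by decide) (by omega) (by rw [h40]; exact h₃)))))
  refine key.mono ?_
  have : (q - (n + 2) ^ e) * (3 * q + 6) ≤ q * (3 * q + 6) :=
    Nat.mul_le_mul_right _ (Nat.sub_le _ _)
  omega

/-- With the field size `q` in register `10`, write `q ^ n` into register `11`, where `n` is in
register `0`. -/
def leftSizeProg : Prog :=
  .seq (.move 41 10) (.seq (.move 42 0) (.seq powProg (.move 11 40)))

theorem exec_leftSizeProg {σ : ℕ → ℕ} {L n q : ℕ} (h0 : σ 0 = n) (h10 : σ 10 = q) (hq : 1 < q)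
    (hqL : q < 2 ^ L) (hnL : q ^ n < 2 ^ L) :
    ∃ σ', Exec leftSizeProg σ σ' L (3 * n + 9) ∧ σ' 11 = q ^ n := by
  have hnL' : n < 2 ^ L := (Nat.lt_pow_self hq).trans hnL
  have hL : 0 < L := by
    rcases Nat.eq_zero_or_pos L with rfl | h
    · omega
    · exact h
  set σ₁ := Function.update (Function.update σ 41 q) 42 n with hσ₁
  obtain ⟨σ₂, h₂, h40⟩ := exec_powProg (σ := σ₁) (L := L) (b := q) (e := n) (by simp [hσ₁])
    (by simp [hσ₁]) (by omega) hL hqL hnL' hnL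
  refine ⟨Function.update σ₂ 11 (q ^ n), ?_, by simp⟩
  have key := Exec.move_seq (σ := σ) (r := 41) (a := 10) (L := L) (by decide) (by omega)
    (.move_seq (r := 42) (a := 0) (by decide) (by simp; omega)
    (.seq (by simpa [h0, h10, ← hσ₁] using h₂) (.move (r := 11) (a := 40) (by decide) (by omega))))
  rw [h40] at key
  exact key.mono (by omega)

/-- With the field size `q` in register `10`, write the least `q ^ m` with
`K ^ 101 ≤ q ^ (100 * m)` into register `12`, where `K` is in register `1`. -/
def rightSizeProg : Prog :=
  .seq (.move 41 1) (.seq (.const 42 101) (.seq powProg (.seq (.move 13 40) (.seq (.move 41 10)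
    (.seq (.const 42 100) (.seq powProg (.seq (.move 14 40) rightSizeLoop)))))))

theorem exec_rightSizeProg {σ : ℕ → ℕ} {L K q m : ℕ} (h1 : σ 1 = K) (h10 : σ 10 = q) (hq : 1 < q)
    (hK : 0 < K) (hm : K ^ 101 ≤ q ^ (100 * m)) (hmin : ∀ i < m, q ^ (100 * i) < K ^ 101)
    (hL : 7 ≤ L) (hKL : K ^ 101 < 2 ^ L) (hqL : q ^ 100 < 2 ^ L) (hmL : q ^ (100 * m) < 2 ^ L) :
    ∃ σ', Exec rightSizeProg σ σ' L (4 * m + 700) ∧ σ' 12 = q ^ m := by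
  have hqL' : q < 2 ^ L := (Nat.le_self_pow (by omega) q).trans_lt hqL
  have hKL' : K < 2 ^ L := (Nat.le_self_pow (by omega) K).trans_lt hKL
  have hL128 : 2 ^ 7 ≤ 2 ^ L := Nat.pow_le_pow_right (by omega) hL
  set P := K ^ 101 with hP
  set Q := q ^ 100 with hQ
  set σ₁ := Function.update (Function.update σ 41 K) 42 101 with hσ₁
  obtain ⟨σ₂, h₂, h40⟩ := exec_powProg (σ := σ₁) (L := L) (b := K) (e := 101) (by simp [hσ₁])
    (by simp [hσ₁]) hK (by omega) hKL' (by omega) hKL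
  have h10₂ : σ₂ 10 = q := by rw [h₂.frame (by decide)]; simp [hσ₁, h10]
  set σ₃ := Function.update (Function.update (Function.update σ₂ 13 P) 41 q) 42 100 with hσ₃
  obtain ⟨σ₄, h₄, h40'⟩ := exec_powProg (σ := σ₃) (L := L) (b := q) (e := 100) (by simp [hσ₃])
    (by simp [hσ₃]) (by omega) (by omega) hqL' (by omega) hqL
  have h10₄ : σ₄ 10 = q := by rw [h₄.frame (by decide)]; simp [hσ₃, h10₂]
  have h13₄ : σ₄ 13 = P := by rw [h₄.frame (by decide)]; simp [hσ₃]
  rw [← hP] at h40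
  rw [← hQ] at h40'
  obtain ⟨σ₅, h₅, h12⟩ := exec_rightSizeLoop (σ := Function.update σ₄ 14 Q) (L := L) (P := P)
    (q := q) (m := m) hq (by simp [h10₄]) (by simp [h13₄]) (by simp [hQ]) hm hmin hKL hqL hmL
  refine ⟨σ₅, ?_, h12⟩
  have key := Exec.move_seq (σ := σ) (r := 41) (a := 1) (L := L) (by decide) (by omega)
    (.const_seq (r := 42) (c := 101) (by omega) (.seq (by simpa [h1, ← hσ₁] using h₂)
    (.move_seq (r := 13) (a := 40) (by decide) (by omega)
    (.move_seq (r := 41) (a := 10) (by decide) (by simp; omega)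
    (.const_seq (r := 42) (c := 100) (by omega)
    (.seq (by simpa [h40, h10₂, ← hσ₃] using h₄)
    (.move_seq (r := 14) (a := 40) (by decide) (by omega) (by rw [h40']; exact h₅))))))))
  exact key.mono (by omega)

/-- Write the Taylor shift by register `21` of the encoded polynomial in register `20` into register
`28`, with `q` and `q ^ n` in the registers `10` and `11`. -/
def shiftProg : Prog :=
  .seq (.arith .mul 22 11 11) (.seq (.const 6 1) (.seq (.arith .add 22 22 6)
    (.seq (.arith .add 23 22 21) (.seq (.const 24 0) (.seq (.const 25 1) (.seq evalDigitsLoop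
    (.seq (.const 27 1) (.seq (.const 28 0) reduceDigitsLoop))))))))

theorem exec_shiftProg {σ : ℕ → ℕ} {L q n x y : ℕ} (hq : 1 < q) (hn : 0 < n) (h10 : σ 10 = q)
    (h11 : σ 11 = q ^ n) (h20 : σ 20 = x) (h21 : σ 21 = y) (hx : x < q ^ n) (hy : y ≤ q)
    (hL : ((q ^ n) ^ 2 + 1) * ((q ^ n) ^ 2 + 1 + q) ^ n < 2 ^ L) :
    ∃ σ', Exec shiftProg σ σ' L (6 * n + 7 * L + 20) ∧ σ' 28 = vertexShift q n y x := by
  have hqn : q ≤ q ^ n := Nat.le_self_pow (by omega) q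
  have hqn2 : q ^ n ≤ (q ^ n) ^ 2 := Nat.le_self_pow (by omega) _
  set N := q ^ n with hN
  set B := N ^ 2 + 1 with hB
  set β := B + y with hβ
  set ds := Nat.digits q x with hds
  have hlen : ds.length ≤ n := (Nat.digits_length_le_iff hq x).mpr hx
  have hpow : B * β ^ ds.length < 2 ^ L := by
    refine lt_of_le_of_lt (Nat.mul_le_mul_left _ ?_) hL
    exact (Nat.pow_le_pow_left (by omega) _).trans (Nat.pow_le_pow_right (by omega) hlen)
  have hpow' : β ^ ds.length < 2 ^ L :=
    lt_of_le_of_lt (Nat.le_mul_of_pos_left _ (by omega)) hpow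
  set R := Nat.ofDigits β ds with hR
  have hRlt : R < β ^ ds.length := Nat.ofDigits_lt_base_pow_length (by omega) fun a ha =>
    (Nat.digits_lt_base hq ha).trans (by omega)
  have hBR : B * R < 2 ^ L := (Nat.mul_le_mul_left _ hRlt.le).trans_lt hpow
  have hBq : B + q < 2 ^ L := by
    refine lt_of_le_of_lt ?_ hL
    exact (Nat.le_self_pow (by omega) _).trans (Nat.le_mul_of_pos_left _ (by omega))
  have hLpos : 1 < 2 ^ L := by omega
  have hNN : N * N = N ^ 2 := by ring
  have hRL : R < 2 ^ L := hRlt.trans hpow'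
  set es := Nat.digits B R with hes
  -- `B ^ es.length` is at most `B * R`, up to the case of an empty list of digits
  have hBes : B ^ es.length < 2 ^ L := by
    rcases Nat.eq_zero_or_pos R with h | h
    · simp [hes, h, hLpos]
    · exact (Nat.base_pow_length_digits_le B R (by omega) (by omega)).trans_lt hBR
  have hesL : es.length ≤ L := by
    have h1 : 2 ^ es.length ≤ B ^ es.length := Nat.pow_le_pow_left (by omega) _
    exact ((Nat.pow_lt_pow_iff_right (by omega)).mp (h1.trans_lt hBes)).le
  have hqes : q ^ es.length < 2 ^ L := (Nat.pow_le_pow_left (by omega) _).trans_lt hBes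
  have hout : Nat.ofDigits q (es.map (· % q)) < 2 ^ L := by
    refine lt_trans (Nat.ofDigits_lt_base_pow_length (b := q) hq fun a ha => ?_) (by simpa using hqes)
    obtain ⟨b, _, rfl⟩ := List.mem_map.mp ha
    exact Nat.mod_lt _ (by omega)
  set σ₁ := Function.update (Function.update (Function.update (Function.update (Function.update
    (Function.update σ 22 (N * N)) 6 1) 22 B) 23 β) 24 0) 25 1 with hσ₁
  obtain ⟨σ₂, h₂, h24⟩ := exec_evalDigitsLoop (L := L) (q := q) (β := β) hq (by omega) (by omega)
    (by omega) x σ₁ (by simp [hσ₁, h20]) (by simp [hσ₁, h10]) (by simp [hσ₁]) (by omega)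
    (by simpa [hσ₁] using hpow') (by simpa [hσ₁] using hRL)
  have h10₂ : σ₂ 10 = q := by rw [h₂.frame (by decide)]; simp [hσ₁, h10]
  have h22₂ : σ₂ 22 = B := by rw [h₂.frame (by decide)]; simp [hσ₁]
  have h24₂ : σ₂ 24 = R := by rw [h24]; simp [hσ₁, ← hR, ← hds]
  set σ₃ := Function.update (Function.update σ₂ 27 1) 28 0 with hσ₃
  obtain ⟨σ₄, h₄, h28⟩ := exec_reduceDigitsLoop (L := L) (q := q) (B := B) hq (by omega) (by omega)
    (by omega) R σ₃ (by simp [hσ₃, h24₂]) (by simp [hσ₃, h10₂]) (by simp [hσ₃, h22₂]) hRL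
    (by simpa [hσ₃] using hqes) (by simpa [hσ₃] using hout)
  refine ⟨σ₄, ?_, ?_⟩
  · have key := Exec.arith_seq (op := .mul) (r := 22) (a := 11) (b := 11) (σ := σ) (L := L)
      (by omega) (by omega) (.const_seq (r := 6) (c := 1) hLpos
      (.arith_seq (op := .add) (r := 22) (a := 22) (b := 6)
        (by simp [ArithOp.eval, h11]; omega) (by simpa using hLpos)
      (.arith_seq (op := .add) (r := 23) (a := 22) (b := 21)
        (by simp [ArithOp.eval, h11]; omega) (by simp; omega)
      (.const_seq (r := 24) (c := 0) (by omega) (.const_seq (r := 25) (c := 1) hLpos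
      (.seq (σ₁ := σ₂) (by
          have e : N * N + 1 = B := by rw [hNN]
          simpa [ArithOp.eval, h11, h21, e, ← hβ, ← hσ₁] using h₂)
      (.const_seq (r := 27) (c := 1) hLpos (.const_seq (r := 28) (c := 0) (by omega) h₄))))))))
    refine key.mono ?_
    rw [← hds, ← hes]
    omega
  · rw [h28]
    simp [hσ₃, vertexShift, numShift, hR, hβ, hB, hN, hds]

/-- The program for the parameters `q`, `q ^ n` and `q ^ m`, in the registers `10`, `11`, `12`. -/
def paramProg (e : ℕ) : Prog := .seq (fieldSizeProg e) (.seq leftSizeProg rightSizeProg)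

/-- The assumptions on the parameters under which the programs run correctly. The field size `q` is
the least prime above `(n + 2) ^ e`, and `s + 1` is the least `m` with `K ^ 101 ≤ q ^ (100 * m)`. -/
structure IsParam (e n K q s : ℕ) : Prop where
  n_pos : 0 < n
  e_pos : 0 < e
  K_pos : 0 < K
  s_lt : s < n
  K_le : K ≤ q ^ n
  prime : q.Prime
  lt_q : (n + 2) ^ e < q
  q_le : q ≤ 2 * (n + 2) ^ e
  not_prime : ∀ x, (n + 2) ^ e < x → x < q → ¬ x.Prime
  pow_le : K ^ 101 ≤ q ^ (100 * (s + 1))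
  lt_pow : ∀ i < s + 1, q ^ (100 * i) < K ^ 101

/-- The number `L` bounds the bit length of all numbers in the computation. -/
structure IsSizeBound (e n q L : ℕ) : Prop where
  e_lt : e < 2 ^ L
  seven_le : 7 ≤ L
  pow_lt : (q ^ n) ^ 101 < 2 ^ L
  shift_lt : ((q ^ n) ^ 2 + 1) * ((q ^ n) ^ 2 + 1 + q) ^ n < 2 ^ L

variable {e n K q s L : ℕ}

theorem exec_paramProg (h : IsParam e n K q s) (hL : IsSizeBound e n q L) {σ : ℕ → ℕ}
    (h0 : σ 0 = n) (h1 : σ 1 = K) :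
    ∃ σ', Exec (paramProg e) σ σ' L (q * (3 * q + 6) + 3 * e + 7 * n + 720) ∧
      σ' 10 = q ∧ σ' 11 = q ^ n ∧ σ' 12 = q ^ (s + 1) := by
  have hq := h.prime.one_lt
  have hN : q ^ n < 2 ^ L := (Nat.le_self_pow (by omega) _).trans_lt hL.pow_lt
  have hqN : q ≤ q ^ n := Nat.le_self_pow h.n_pos.ne' q
  obtain ⟨σ₁, h₁, h10⟩ := exec_fieldSizeProg (L := L) h0 h.e_pos hL.e_lt h.lt_q h.prime h.not_prime
    (by omega)
  obtain ⟨σ₂, h₂, h11⟩ := exec_leftSizeProg (L := L) (σ := σ₁) (n := n) (q := q)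
    (by rw [h₁.frame (by simp [fieldSizeProg, powProg, nextPrimeProg, Prog.move, Prog.writes]), h0])
    h10 hq (by omega) hN
  have h10₂ : σ₂ 10 = q := by rw [h₂.frame (by decide), h10]
  have h1₂ : σ₂ 1 = K := by
    rw [h₂.frame (by decide),
      h₁.frame (by simp [fieldSizeProg, powProg, nextPrimeProg, Prog.move, Prog.writes]), h1]
  obtain ⟨σ₃, h₃, h12⟩ := exec_rightSizeProg (L := L) h1₂ h10₂ hq h.K_pos h.pow_le h.lt_pow
    hL.seven_le ((Nat.pow_le_pow_left h.K_le 101).trans_lt hL.pow_lt)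
    (lt_of_le_of_lt ((Nat.pow_le_pow_left hqN 100).trans
      (Nat.pow_le_pow_right (by omega) (by omega))) hL.pow_lt)
    (by
      refine lt_of_le_of_lt ?_ hL.pow_lt
      rw [← pow_mul]
      have := h.s_lt
      exact Nat.pow_le_pow_right (by omega) (by nlinarith))
  refine ⟨σ₃, (h₁.seq (h₂.seq h₃)).mono ?_, ?_, ?_, h12⟩
  · have := h.s_lt
    omega
  · rw [h₃.frame (by decide), h10₂]
  · rw [h₃.frame (by decide), h11]

theorem notMem_writes_paramProg {r : ℕ} (hr : r < 4) : r ∉ (paramProg e).writes := by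
  simp [paramProg, fieldSizeProg, leftSizeProg, rightSizeProg, rightSizeLoop, powProg,
    nextPrimeProg, Prog.move, Prog.writes]
  omega

/-- The left neighborhood function, with the vertex and the label in the registers `2` and `3`. -/
def leftProg (e : ℕ) : Prog :=
  .seq (paramProg e) (.seq (.move 20 2) (.seq (.move 21 3) (.seq shiftProg
    (.seq (.arith .div 30 12 10) (.seq (.arith .mod 31 28 30) (.seq (.arith .mul 31 31 10)
    (.arith .add 0 3 31)))))))

/-- The right neighborhood function, with the vertex and the label in the registers `2` and
`3`. -/
def rightProg (e : ℕ) : Prog :=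
  .seq (paramProg e) (.seq (.arith .mod 31 2 10) (.seq (.arith .sub 21 10 31)
    (.seq (.arith .div 20 2 10) (.seq (.arith .div 30 12 10) (.seq (.arith .mul 30 30 3)
    (.seq (.arith .add 20 20 30) (.seq shiftProg (.move 0 28))))))))

theorem exec_leftProg (h : IsParam e n K q s) (hL : IsSizeBound e n q L) {σ : ℕ → ℕ} {x i : ℕ}
    (h0 : σ 0 = n) (h1 : σ 1 = K) (h2 : σ 2 = x) (h3 : σ 3 = i) (hx : x < q ^ n) (hi : i < q) :
    ∃ σ', Exec (leftProg e) σ σ' L (q * (3 * q + 6) + 3 * e + 13 * n + 7 * L + 760) ∧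
      σ' 0 = i + q * (vertexShift q n i x % q ^ s) := by
  have hq := h.prime.one_lt
  have hN : q ^ n < 2 ^ L := (Nat.le_self_pow (by omega) _).trans_lt hL.pow_lt
  have hqN : q ≤ q ^ n := Nat.le_self_pow h.n_pos.ne' q
  have hs1 : q ^ (s + 1) ≤ q ^ n := Nat.pow_le_pow_right (by omega) h.s_lt
  have hs : q ^ (s + 1) / q = q ^ s := by rw [pow_succ]; exact Nat.mul_div_cancel _ (by omega)
  obtain ⟨σ₁, h₁, h10, h11, h12⟩ := exec_paramProg h hL h0 h1
  have h2' : σ₁ 2 = x := by rw [h₁.frame (notMem_writes_paramProg (by omega)), h2]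
  have h3' : σ₁ 3 = i := by rw [h₁.frame (notMem_writes_paramProg (by omega)), h3]
  set σ₂ := Function.update (Function.update σ₁ 20 x) 21 i with hσ₂
  obtain ⟨σ₃, h₃, h28⟩ := exec_shiftProg (σ := σ₂) (L := L) (q := q) (n := n) (x := x) (y := i) hq
    h.n_pos (by simp [hσ₂, h10]) (by simp [hσ₂, h11]) (by simp [hσ₂]) (by simp [hσ₂]) hx hi.le
    hL.shift_lt
  have h10₃ : σ₃ 10 = q := by rw [h₃.frame (by decide)]; simp [hσ₂, h10]
  have h12₃ : σ₃ 12 = q ^ (s + 1) := by rw [h₃.frame (by decide)]; simp [hσ₂, h12]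
  have h3₃ : σ₃ 3 = i := by rw [h₃.frame (by decide)]; simp [hσ₂, h3']
  have hv := vertexShift_lt hq h.n_pos hi.le hx
  set v := vertexShift q n i x with hvdef
  have hvs : v % q ^ s < q ^ s := Nat.mod_lt _ (by positivity)
  have hmul : v % q ^ s * q < q ^ (s + 1) := by
    rw [pow_succ]
    exact Nat.mul_lt_mul_of_pos_right hvs (by omega)
  have hsL : q ^ s ≤ q ^ (s + 1) := Nat.pow_le_pow_right (by omega) (by omega)
  have key := h₁.seq (Exec.move_seq (r := 20) (a := 2) (by decide) (by omega)
    (.move_seq (r := 21) (a := 3) (by decide) (by simp; omega)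
    (.seq (σ₁ := σ₃) (by simpa [h2', h3', ← hσ₂] using h₃)
    (.arith_seq (op := .div) (r := 30) (a := 12) (b := 10) (by omega) (by omega)
    (.arith_seq (op := .mod) (r := 31) (a := 28) (b := 30) (by simp; omega)
      (by simp [ArithOp.eval, h12₃, h10₃, hs]; omega)
    (.arith_seq (op := .mul) (r := 31) (a := 31) (b := 10)
      (by simp [ArithOp.eval, h12₃, h10₃, hs, h28]; omega) (by simp; omega)
    (.arith (op := .add) (r := 0) (a := 3) (b := 31) (by simp; omega)
      (by simp [ArithOp.eval, h12₃, h10₃, hs, h28]; omega))))))))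
  refine ⟨_, key.mono (by omega), ?_⟩
  simp [ArithOp.eval, h12₃, h10₃, hs, h28, h3₃, mul_comm]

theorem exec_rightProg (h : IsParam e n K q s) (hL : IsSizeBound e n q L) {σ : ℕ → ℕ} {w j : ℕ}
    (h0 : σ 0 = n) (h1 : σ 1 = K) (h2 : σ 2 = w) (h3 : σ 3 = j) (hw : w < q ^ (s + 1))
    (hj : j < q ^ (n - s)) :
    ∃ σ', Exec (rightProg e) σ σ' L (q * (3 * q + 6) + 3 * e + 13 * n + 7 * L + 760) ∧
      σ' 0 = vertexShift q n (q - w % q) (w / q + q ^ s * j) := by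
  have hq := h.prime.one_lt
  have hN : q ^ n < 2 ^ L := (Nat.le_self_pow (by omega) _).trans_lt hL.pow_lt
  have hqN : q ≤ q ^ n := Nat.le_self_pow h.n_pos.ne' q
  have hs1 : q ^ (s + 1) ≤ q ^ n := Nat.pow_le_pow_right (by omega) h.s_lt
  have hs : q ^ (s + 1) / q = q ^ s := by rw [pow_succ]; exact Nat.mul_div_cancel _ (by omega)
  have hsL : q ^ s ≤ q ^ (s + 1) := Nat.pow_le_pow_right (by omega) (by omega)
  have hjN : q ^ (n - s) ≤ q ^ n := Nat.pow_le_pow_right (by omega) (Nat.sub_le _ _)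
  obtain ⟨σ₁, h₁, h10, h11, h12⟩ := exec_paramProg h hL h0 h1
  have h2' : σ₁ 2 = w := by rw [h₁.frame (notMem_writes_paramProg (by omega)), h2]
  have h3' : σ₁ 3 = j := by rw [h₁.frame (notMem_writes_paramProg (by omega)), h3]
  have hlt := div_add_pow_mul_lt hq h.s_lt.le hw hj
  set x := w / q + q ^ s * j with hxdef
  have hjx : q ^ s * j ≤ x := Nat.le_add_left _ _
  have hdiv : w / q ≤ w := Nat.div_le_self _ _
  have hmod : w % q < q := Nat.mod_lt _ (by omega)
  set σ₂ := Function.update (Function.update (Function.update (Function.update (Function.update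
    (Function.update σ₁ 31 (w % q)) 21 (q - w % q)) 20 (w / q)) 30 (q ^ s)) 30 (q ^ s * j)) 20 x
    with hσ₂
  obtain ⟨σ₃, h₃, h28⟩ := exec_shiftProg (σ := σ₂) (L := L) (q := q) (n := n) (x := x)
    (y := q - w % q) hq h.n_pos (by simp [hσ₂, h10]) (by simp [hσ₂, h11]) (by simp [hσ₂])
    (by simp [hσ₂]) hlt (Nat.sub_le _ _) hL.shift_lt
  have hv := vertexShift_lt hq h.n_pos (Nat.sub_le q (w % q)) hlt
  have key := h₁.seq (.arith_seq (op := .mod) (r := 31) (a := 2) (b := 10) (by omega) (by omega)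
    (.arith_seq (op := .sub) (r := 21) (a := 10) (b := 31) (by simp; omega)
      (by simp [ArithOp.eval, h2', h10]; omega)
    (.arith_seq (op := .div) (r := 20) (a := 2) (b := 10) (by simp; omega) (by simp; omega)
    (.arith_seq (op := .div) (r := 30) (a := 12) (b := 10) (by simp; omega) (by simp; omega)
    (.arith_seq (op := .mul) (r := 30) (a := 30) (b := 3)
      (by simp [ArithOp.eval, h10, h12, hs]; omega) (by simp; omega)
    (.arith_seq (op := .add) (r := 20) (a := 20) (b := 30)
      (by simp [ArithOp.eval, h10, h2']; omega)
      (by simp [ArithOp.eval, h10, h12, h3', hs]; omega)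
    (.seq (σ₁ := σ₃) (by simpa [ArithOp.eval, h10, h12, h2', h3', hs, ← hxdef, hσ₂] using h₃)
    (.move (r := 0) (a := 28) (by decide) (by omega)))))))))
  refine ⟨_, key.mono (by omega), ?_⟩
  simp [h28]

end Programs

/-! ### The time bound -/

section Describes

/-- A bound on the bit length of the numbers in the computation, in terms of `S`, the bit length of
the number of left vertices plus one. -/
def sizeBound (e S : ℕ) : ℕ := 1000 * S ^ 2 + e

theorem sizeBound_le (e : ℕ) {S : ℕ} (hS : 0 < S) : sizeBound e S ≤ (1000 + e) * S ^ 2 := by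
  have : 1 ≤ S ^ 2 := Nat.one_le_pow _ _ hS
  rw [sizeBound]
  nlinarith

theorem isSizeBound_sizeBound {e n q : ℕ} (hq : 1 < q) (hn : 0 < n) :
    IsSizeBound e n q (sizeBound e ((q ^ n).size + 1)) := by
  set N := q ^ n with hN
  set t := N.size with ht
  have hNt : N < 2 ^ t := Nat.lt_size_self N
  have hnt : n < t := by
    rw [ht, Nat.lt_size]
    exact Nat.pow_le_pow_left hq n
  have hqN : q ≤ N := Nat.le_self_pow (by omega) q
  have hlt : ∀ a k, a < 2 ^ k → k ≤ sizeBound e (t + 1) → a < 2 ^ sizeBound e (t + 1) :=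
    fun a k ha hk => ha.trans_le (Nat.pow_le_pow_right (by omega) hk)
  have h1000 : 1000 * (t + 1) ^ 2 ≤ sizeBound e (t + 1) := Nat.le_add_right _ _
  refine ⟨hlt e e Nat.lt_two_pow_self (Nat.le_add_left _ _), ?_, ?_, ?_⟩
  · nlinarith
  · refine hlt _ (t * 101) ?_ (by nlinarith)
    rw [pow_mul]
    exact Nat.pow_lt_pow_left hNt (by omega)
  · have hB : N ^ 2 + 1 ≤ 2 ^ (t * 2) := by
      rw [pow_mul]
      exact Nat.pow_lt_pow_left hNt (by omega)
    have hBq : N ^ 2 + 1 + q ≤ 2 ^ (t * 2 + 1) := by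
      have : 2 ^ t ≤ 2 ^ (t * 2) := Nat.pow_le_pow_right (by omega) (by omega)
      rw [pow_succ 2 (t * 2)]
      omega
    refine hlt _ (t * 2 + (t * 2 + 1) * n + 1) ?_ (by nlinarith)
    refine lt_of_le_of_lt (Nat.mul_le_mul hB (Nat.pow_le_pow_left hBq n)) ?_
    rw [← pow_mul, ← pow_add]
    exact Nat.pow_lt_pow_right (by omega) (Nat.lt_succ_self _)

/-- The programs of the multiplicity code graph. With `S` as in `sizeBound`, the constant `c` bounds
the number of instructions divided by `S ^ (2 * e + 2)`, times the cost `(L + 1) ^ 2` of a single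
instruction divided by `S ^ 4`. -/
def multiplicityProgram (e : ℕ) : GraphProgram where
  leftSize := .seq (paramProg e) (.move 0 11)
  leftDegree := .seq (paramProg e) (.move 0 10)
  rightSize := .seq (paramProg e) (.move 0 12)
  left := leftProg e
  right := rightProg e
  c := (7784 + 10 * e) * (1001 + e) ^ 2

/-- The search for `q` by trial division dominates: it takes about `q ^ 2` instructions, and `q` is
at most `S ^ (e + 1)`. -/
theorem IsParam.time_le {e n K q s : ℕ} (h : IsParam e n K q s) :
    (q * (3 * q + 6) + 3 * e + 13 * n + 7 * sizeBound e ((q ^ n).size + 1) + 760)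
        * (sizeBound e ((q ^ n).size + 1) + 1) ^ 2
      ≤ (multiplicityProgram e).c * ((q ^ n).size + 1) ^ (multiplicityProgram e).c := by
  set S := (q ^ n).size + 1 with hS
  have hn : n + 2 ≤ S := by
    have : n < (q ^ n).size := by
      rw [Nat.lt_size]
      exact Nat.pow_le_pow_left h.prime.two_le n
    omega
  have hL := sizeBound_le e (show 0 < S by omega)
  set L := sizeBound e S
  have hq : q ≤ S ^ (e + 1) := by
    refine h.q_le.trans ?_
    rw [pow_succ, mul_comm]
    exact Nat.mul_le_mul (Nat.pow_le_pow_left hn e) (by omega)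
  set Z := S ^ (2 * e + 2) with hZ
  have hqZ : q * q ≤ Z := by
    refine (Nat.mul_le_mul hq hq).trans (le_of_eq ?_)
    rw [hZ, ← pow_add]
    congr 1
    ring
  have hqq : q ≤ q * q := Nat.le_mul_self q
  have hSZ : S ^ 2 ≤ Z := Nat.pow_le_pow_right (by omega) (by omega)
  have hSS : S ≤ S ^ 2 := Nat.le_self_pow (by omega) S
  have hZ1 : 1 ≤ Z := Nat.one_le_pow _ _ (by omega)
  have hk : q * (3 * q + 6) + 3 * e + 13 * n + 7 * L + 760 ≤ (7784 + 10 * e) * Z := by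
    have h1 : L ≤ (1000 + e) * Z := hL.trans (Nat.mul_le_mul_left _ hSZ)
    have h2 : e ≤ e * Z := Nat.le_mul_of_pos_right _ hZ1
    nlinarith
  have hL2 : (L + 1) ^ 2 ≤ (1001 + e) ^ 2 * S ^ 4 := by
    have h1 : L + 1 ≤ (1001 + e) * S ^ 2 := by nlinarith
    calc (L + 1) ^ 2 ≤ ((1001 + e) * S ^ 2) ^ 2 := Nat.pow_le_pow_left h1 2
      _ = (1001 + e) ^ 2 * S ^ 4 := by ring
  calc _ ≤ ((7784 + 10 * e) * Z) * ((1001 + e) ^ 2 * S ^ 4) := Nat.mul_le_mul hk hL2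
    _ = (multiplicityProgram e).c * S ^ (2 * e + 6) := by
      rw [multiplicityProgram, hZ, show 2 * e + 6 = 2 * e + 2 + 4 by ring, pow_add S (2 * e + 2)]
      ring
    _ ≤ _ := by
      refine Nat.mul_le_mul_left _ (Nat.pow_le_pow_right (by omega) ?_)
      have h1 : 1 ≤ (1001 + e) ^ 2 := Nat.one_le_pow _ _ (by omega)
      calc 2 * e + 6 ≤ (7784 + 10 * e) * 1 := by omega
        _ ≤ (multiplicityProgram e).c := Nat.mul_le_mul_left _ h1

theorem Exec.computesWithin {p : Prog} {input : List ℕ} {σ' : ℕ → ℕ} {L k out T : ℕ}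
    (h : Exec p (fun r => input.getD r 0) σ' L k) (hout : σ' 0 = out)
    (hT : k * (L + 1) ^ 2 ≤ T) : p.ComputesWithin input out T :=
  let ⟨t, ht, htk⟩ := h
  ⟨σ', t, ht, hout, htk.trans hT⟩

theorem IsParam.describes {e n K q s : ℕ} (h : IsParam e n K q s) :
    (multiplicityProgram e).Describes n K
      (multiplicityGraph q n s h.prime.one_lt h.n_pos h.s_lt.le) := by
  have hL := isSizeBound_sizeBound (e := e) h.prime.one_lt h.n_pos
  have hT := h.time_le
  set L := sizeBound e ((q ^ n).size + 1)
  obtain ⟨σ, hσ, h10, h11, h12⟩ := exec_paramProg h hL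
    (σ := fun r => [n, K].getD r 0) rfl rfl
  have hN : q ^ n < 2 ^ L := (Nat.le_self_pow (by omega) _).trans_lt hL.pow_lt
  have hqN : q ≤ q ^ n := Nat.le_self_pow h.n_pos.ne' q
  have hsN : q ^ (s + 1) ≤ q ^ n := Nat.pow_le_pow_right h.prime.pos h.s_lt
  have hT' : (q * (3 * q + 6) + 3 * e + 7 * n + 720 + 2) * (L + 1) ^ 2 ≤ _ :=
    (Nat.mul_le_mul_right _ (by omega)).trans hT
  refine ⟨?_, ?_, ?_, fun x i => ?_, fun w j => ?_⟩
  · exact (hσ.seq (.move (by decide) (by omega))).computesWithin (by simp [h11]) hT'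
  · exact (hσ.seq (.move (by decide) (by omega))).computesWithin (by simp [h10]) hT'
  · exact (hσ.seq (.move (by decide) (by omega))).computesWithin (by simp [h12]) hT'
  · obtain ⟨τ, hτ, h0⟩ := exec_leftProg h hL (σ := fun r => [n, K, (x : ℕ), (i : ℕ)].getD r 0)
      rfl rfl rfl rfl x.2 i.2
    exact hτ.computesWithin h0 hT
  · obtain ⟨τ, hτ, h0⟩ := exec_rightProg h hL (σ := fun r => [n, K, (w : ℕ), (j : ℕ)].getD r 0)
      rfl rfl rfl rfl w.2 j.2
    exact hτ.computesWithin h0 hT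

end Describes

/-! ### The choice of parameters -/

section Parameters

/-- The least prime above `a`. -/
def nextPrime (a : ℕ) : ℕ := Nat.find (Nat.exists_infinite_primes (a + 1))

theorem lt_nextPrime (a : ℕ) : a < nextPrime a :=
  (Nat.find_spec (Nat.exists_infinite_primes (a + 1))).1

theorem prime_nextPrime (a : ℕ) : (nextPrime a).Prime :=
  (Nat.find_spec (Nat.exists_infinite_primes (a + 1))).2

theorem nextPrime_le {a p : ℕ} (hp : p.Prime) (h : a < p) : nextPrime a ≤ p :=
  Nat.find_min' _ ⟨h, hp⟩

theorem nextPrime_le_two_mul {a : ℕ} (ha : a ≠ 0) : nextPrime a ≤ 2 * a := by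
  obtain ⟨p, hp, h1, h2⟩ := Nat.exists_prime_lt_and_le_two_mul a ha
  exact (nextPrime_le hp h1).trans h2

theorem nextPrime_mono : Monotone nextPrime := fun _ b hab =>
  nextPrime_le (prime_nextPrime b) (hab.trans_lt (lt_nextPrime b))

/-- The field size for the parameter `n`. -/
def fieldSize (n : ℕ) : ℕ := nextPrime ((n + 2) ^ 204)

theorem prime_fieldSize (n : ℕ) : (fieldSize n).Prime := prime_nextPrime _

theorem pow_lt_fieldSize (n : ℕ) : (n + 2) ^ 204 < fieldSize n := lt_nextPrime _

theorem fieldSize_le (n : ℕ) : fieldSize n ≤ 2 * (n + 2) ^ 204 :=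
  nextPrime_le_two_mul (pow_ne_zero _ (by omega))

theorem strictMono_fieldSize_pow : StrictMono fun n => fieldSize n ^ n := by
  refine strictMono_nat_of_lt_succ fun n => ?_
  have h1 : fieldSize n ≤ fieldSize (n + 1) :=
    nextPrime_mono (Nat.pow_le_pow_left (by omega) _)
  exact (Nat.pow_le_pow_left h1 n).trans_lt
    (Nat.pow_lt_pow_right (prime_fieldSize _).one_lt (Nat.lt_succ_self n))

/-- There are enough differential polynomials of degree below `q / (100 * n ^ 2)` in each variable
to interpolate `q * K` jets. With `m = s + 1`, the 101st power of the claim follows from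
`(200 * n ^ 2) ^ (101 * m) * q ^ 101 < q ^ m`. Here `q` exceeds `n ^ 204`, and `204` exceeds
`2 * 101` by two: one factor `n ^ m` pays for the constant `200`, the other one for `q ^ 101`. -/
theorem mul_lt_div_pow {q n m K : ℕ} (hn : 200 ^ 101 < n) (hm : 20604 ≤ m) (hq : n ^ 204 < q)
    (hK : K ^ 101 ≤ q ^ (100 * m)) : q * K < (q / (100 * n ^ 2)) ^ m := by
  have hn1 : 1 < n := lt_of_le_of_lt (Nat.one_le_pow _ _ (by omega)) hn
  have hn0 : 0 < 100 * n ^ 2 := by positivity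
  set d := q / (100 * n ^ 2) with hd
  have hq' : 100 * n ^ 2 ≤ q := by
    have h1 : 100 ≤ n := le_trans (by norm_num) hn.le
    calc 100 * n ^ 2 ≤ n * n ^ 2 := Nat.mul_le_mul_right _ h1
      _ = n ^ 3 := by ring
      _ ≤ n ^ 204 := Nat.pow_le_pow_right (by omega) (by omega)
      _ ≤ q := hq.le
  have hd1 : 1 ≤ d := (Nat.one_le_div_iff hn0).mpr hq'
  have hqd : q ≤ 200 * n ^ 2 * d := by
    have h1 := Nat.div_add_mod q (100 * n ^ 2)
    have h2 := Nat.mod_lt q hn0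
    rw [← hd] at h1
    nlinarith
  have key : (200 * n ^ 2) ^ (101 * m) * q ^ 101 < q ^ m := by
    obtain ⟨j, rfl⟩ : ∃ j, m = j + 101 := ⟨m - 101, by omega⟩
    have hj : j + 101 + 2 * (101 * (j + 101)) ≤ 204 * j := by
      linarith only [hm]
    have h1 : 200 ^ (101 * (j + 101)) < n ^ (j + 101) := by
      rw [pow_mul]
      exact Nat.pow_lt_pow_left hn (by omega)
    have h2 : (200 * n ^ 2) ^ (101 * (j + 101)) < q ^ j := by
      calc (200 * n ^ 2) ^ (101 * (j + 101))
          = 200 ^ (101 * (j + 101)) * n ^ (2 * (101 * (j + 101))) := by rw [mul_pow, ← pow_mul]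
        _ < n ^ (j + 101) * n ^ (2 * (101 * (j + 101))) :=
            Nat.mul_lt_mul_of_pos_right h1 (pow_pos (by omega) _)
        _ = n ^ (j + 101 + 2 * (101 * (j + 101))) := by rw [← pow_add]
        _ ≤ n ^ (204 * j) := Nat.pow_le_pow_right hn1.le hj
        _ = (n ^ 204) ^ j := pow_mul _ _ _
        _ ≤ q ^ j := Nat.pow_le_pow_left hq.le j
    rw [pow_add q]
    exact Nat.mul_lt_mul_of_pos_right h2 (pow_pos (by omega) _)
  have h0 : 0 < (200 * n ^ 2) ^ (101 * m) := pow_pos (by positivity) _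
  have hfin : (200 * n ^ 2) ^ (101 * m) * (q * K) ^ 101
      < (200 * n ^ 2) ^ (101 * m) * (d ^ m) ^ 101 := by
    calc (200 * n ^ 2) ^ (101 * m) * (q * K) ^ 101
        = (200 * n ^ 2) ^ (101 * m) * q ^ 101 * K ^ 101 := by rw [mul_pow q, mul_assoc]
      _ ≤ (200 * n ^ 2) ^ (101 * m) * q ^ 101 * q ^ (100 * m) := Nat.mul_le_mul_left _ hK
      _ < q ^ m * q ^ (100 * m) := Nat.mul_lt_mul_of_pos_right key (pow_pos (by omega) _)
      _ = q ^ (101 * m) := by rw [← pow_add]; congr 1; ring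
      _ ≤ (200 * n ^ 2 * d) ^ (101 * m) := Nat.pow_le_pow_left hqd _
      _ = (200 * n ^ 2) ^ (101 * m) * (d ^ m) ^ 101 := by
          rw [mul_pow _ d, ← pow_mul d, mul_comm m]
  exact lt_of_pow_lt_pow_left₀ 101 (Nat.zero_le _) (lt_of_mul_lt_mul_left hfin (Nat.zero_le _))

theorem le_of_pow_le_of_pow_le_pow {q K a m : ℕ} (hq : 1 < q) (ha : q ^ a ≤ K)
    (hm : K ^ 101 ≤ q ^ (100 * m)) : a ≤ m := by
  have h := (Nat.pow_le_pow_left ha 101).trans hm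
  rw [← pow_mul, Nat.pow_le_pow_iff_right hq] at h
  omega

theorem isTwoSidedLossless_multiplicityGraph {q n s K : ℕ} (hp : q.Prime) (hn : 200 ^ 101 < n)
    (hs : 20604 ≤ s + 1) (hsn : s < n) (hq : n ^ 204 < q) (hK : K ^ 101 ≤ q ^ (100 * (s + 1)))
    {x : ℝ} (hx : ⌊x⌋₊ = K) :
    (multiplicityGraph q n s hp.one_lt (Nat.zero_lt_of_lt hsn) hsn.le).IsTwoSidedLossless x 0.01
      (1 / 50 * (1 / (q : ℝ)) * min ((q ^ (s + 1) : ℕ) : ℝ)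
        (((q ^ n : ℕ) : ℝ) / ((q ^ (s + 1) : ℕ) : ℝ))) 0.01 := by
  have hn0 : 0 < n := Nat.zero_lt_of_lt hsn
  have hqR : (0 : ℝ) < q := by exact_mod_cast hp.pos
  refine ⟨fun S hS => ?_, fun T hT => ?_⟩
  · set d := q / (100 * n ^ 2) with hd
    have hcard : S.card ≤ K := hx ▸ Nat.le_floor hS
    have hD : 100 * ((d - 1) * (1 + s * (n - 1))) ≤ q := by
      have h1 : 1 + s * (n - 1) ≤ n ^ 2 := by
        obtain ⟨j, rfl⟩ : ∃ j, n = j + 1 := ⟨n - 1, by omega⟩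
        have hsj : s ≤ j := Nat.lt_succ_iff.mp hsn
        rw [Nat.add_sub_cancel]
        nlinarith only [Nat.mul_le_mul_right j hsj]
      calc 100 * ((d - 1) * (1 + s * (n - 1))) ≤ 100 * (d * n ^ 2) :=
            Nat.mul_le_mul_left _ (Nat.mul_le_mul (Nat.sub_le _ _) h1)
        _ = 100 * n ^ 2 * (q / (100 * n ^ 2)) := by rw [← hd]; ring
        _ ≤ q := Nat.mul_div_le _ _
    have hnq : n ≤ q := (Nat.le_self_pow (by omega) n).trans hq.le
    have key := mul_card_le_card_leftNbrs_multiplicityGraph (d := d) hp.one_lt hn0 hsn.le hp hnq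
      (Nat.div_le_self _ _) (by have := hp.pos; omega) S
      (lt_of_le_of_lt (Nat.mul_le_mul_left q hcard) (mul_lt_div_pow hn hs hq hK))
    set D := (d - 1) * (1 + s * (n - 1))
    have h1 : 99 * q ≤ 100 * (q - D) := by omega
    have h2 : 99 * q * S.card ≤ 100 * ((multiplicityGraph q n s hp.one_lt hn0 hsn.le).leftNbrs
        S).card := by
      calc 99 * q * S.card ≤ 100 * (q - D) * S.card := Nat.mul_le_mul_right _ h1
        _ = 100 * ((q - D) * S.card) := by ring
        _ ≤ _ := Nat.mul_le_mul_left _ key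
    have h3 : (99 : ℝ) * q * S.card ≤ 100 * ((multiplicityGraph q n s hp.one_lt hn0
        hsn.le).leftNbrs S).card := by exact_mod_cast h2
    linarith
  · have key := two_mul_card_mul_le_card_rightNbrs hp.one_lt hn0 hsn.le hp T
    have keyR : 2 * ((q : ℝ) ^ (n - s) * T.card) ≤ 2 * (((multiplicityGraph q n s hp.one_lt hn0
        hsn.le).rightNbrs T).card : ℝ) + (q : ℝ) ^ (n - 2 * s) * (T.card : ℝ) ^ 2 := by
      exact_mod_cast key
    have hq1 : (1 : ℝ) ≤ q := by exact_mod_cast hp.one_lt.le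
    have hB : (q : ℝ) ^ (n - 2 * s) * T.card ≤ 1 / 50 * (q : ℝ) ^ (n - s) := by
      rcases le_total (2 * s) n with h | h
      · have h1 : (T.card : ℝ) ≤ 1 / 50 * (q : ℝ) ^ s := by
          refine hT.trans ((mul_le_mul_of_nonneg_left (min_le_left _ _) (by positivity)).trans
            (le_of_eq ?_))
          push_cast
          rw [pow_succ]
          field_simp
        calc (q : ℝ) ^ (n - 2 * s) * T.card ≤ (q : ℝ) ^ (n - 2 * s) * (1 / 50 * (q : ℝ) ^ s) :=
              mul_le_mul_of_nonneg_left h1 (by positivity)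
          _ = 1 / 50 * ((q : ℝ) ^ (n - 2 * s) * (q : ℝ) ^ s) := by ring
          _ = 1 / 50 * (q : ℝ) ^ (n - s) := by rw [← pow_add]; congr 2; omega
      · rw [Nat.sub_eq_zero_of_le h, pow_zero, one_mul]
        refine hT.trans ((mul_le_mul_of_nonneg_left (min_le_right _ _) (by positivity)).trans ?_)
        rw [mul_assoc]
        refine mul_le_mul_of_nonneg_left ?_ (by norm_num)
        push_cast
        rw [one_div_mul_eq_div, div_div, div_le_iff₀ (by positivity), ← pow_succ, ← pow_add]
        exact pow_le_pow_right₀ hq1 (by omega)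
    have hT2 := mul_le_mul_of_nonneg_right hB (Nat.cast_nonneg (α := ℝ) T.card)
    push_cast
    nlinarith only [keyR, hT2]

theorem exists_isParam {n K : ℕ} (hn : 0 < n) (hK : 1 < K)
    (hKN : K ^ 101 ≤ (fieldSize n ^ n) ^ 100) :
    ∃ s, IsParam 204 n K (fieldSize n) s := by
  classical
  have hp := prime_fieldSize n
  set q := fieldSize n with hq
  have hex : ∃ m, K ^ 101 ≤ q ^ (100 * m) := ⟨n, by rwa [← pow_mul, mul_comm] at hKN⟩
  obtain ⟨s, hs⟩ : ∃ s, Nat.find hex = s + 1 := by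
    refine Nat.exists_eq_add_one.mpr (Nat.pos_of_ne_zero fun h0 => ?_)
    have h1 := Nat.find_spec hex
    rw [h0, mul_zero, pow_zero] at h1
    exact absurd h1 (not_le.mpr (Nat.one_lt_pow (by omega) hK))
  have hfn : Nat.find hex ≤ n := Nat.find_min' hex (by rwa [← pow_mul, mul_comm] at hKN)
  refine ⟨s, hn, by omega, by omega, by omega, ?_, hp, pow_lt_fieldSize n, fieldSize_le n,
    fun x h1 h2 hx => ?_, ?_, fun i hi => ?_⟩
  · refine le_of_not_gt fun h => ?_
    have h1 : (q ^ n) ^ 100 < K ^ 100 := Nat.pow_lt_pow_left h (by omega)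
    have h2 : K ^ 100 ≤ K ^ 101 := Nat.pow_le_pow_right (by omega) (by omega)
    omega
  · exact absurd (nextPrime_le hx h1) (not_le.mpr h2)
  · rw [← hs]; exact Nat.find_spec hex
  · exact lt_of_not_ge (Nat.find_min hex (by omega))

theorem add_two_le_log_fieldSize_pow {n : ℕ} (hn : 1 ≤ n) :
    ((n + 2 : ℕ) : ℝ) ≤ Real.log ((fieldSize n ^ n : ℕ) : ℝ) := by
  have h1 : 2 ^ 204 ≤ fieldSize n :=
    (Nat.pow_le_pow_left (by omega) 204).trans (pow_lt_fieldSize n).le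
  have h2 : (3 : ℝ) ≤ Real.log (fieldSize n) := by
    have h3 : ((2 : ℝ) ^ 204) ≤ fieldSize n := by exact_mod_cast h1
    have h4 := Real.log_le_log (by positivity) h3
    rw [Real.log_pow] at h4
    have h5 := Real.log_two_gt_d9
    push_cast at h4
    linarith
  push_cast
  rw [Real.log_pow]
  have hn' : (1 : ℝ) ≤ n := by exact_mod_cast hn
  nlinarith

end Parameters

theorem mainTheorem4 :
    ∃ (N : ℕ → ℕ) (A : GraphProgram) (C : ℝ) (η : ℕ → ℝ),
      StrictMono N ∧ Filter.Tendsto η Filter.atTop (nhds 0) ∧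
      ∀ δ : ℝ, 0 < δ → δ < 0.99 →
        ∃ n₀ : ℕ, ∀ n : ℕ, n₀ ≤ n →
          ∃ (D M D' : ℕ) (G : BiregularGraph (N n) D M D'),
            A.Describes n ⌊(N n : ℝ) ^ δ⌋₊ G ∧
            (D : ℝ) ≤ C * (Real.log (N n)) ^ 204 ∧
            (N n : ℝ) ^ (1.01 * δ - η n) ≤ (M : ℝ) ∧
            (M : ℝ) ≤ (D : ℝ) * (N n : ℝ) ^ (1.01 * δ) ∧
            G.IsTwoSidedLossless ((N n : ℝ) ^ δ) 0.01
              (1 / 50 * (1 / (D : ℝ)) * min (M : ℝ) ((N n : ℝ) / (M : ℝ))) 0.01 := by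
  refine ⟨fun n => fieldSize n ^ n, multiplicityProgram 204, 2,
    fun n => Real.log 4 / Real.log ((fieldSize n ^ n : ℕ) : ℝ), strictMono_fieldSize_pow, ?_, ?_⟩
  · exact Filter.Tendsto.const_div_atTop (Real.tendsto_log_atTop.comp
      (tendsto_natCast_atTop_atTop.comp strictMono_fieldSize_pow.tendsto_atTop)) _
  intro δ hδ0 hδ1
  obtain ⟨n₁, hn₁⟩ := exists_nat_gt (20606 / δ)
  refine ⟨max n₁ (200 ^ 101 + 1), fun n hn => ?_⟩
  have hnn₁ : n₁ ≤ n := (le_max_left _ _).trans hn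
  have hn200 : 200 ^ 101 < n := (le_max_right _ _).trans hn
  have hn1 : 1 ≤ n := le_trans (Nat.one_le_pow _ _ (by omega)) hn200.le
  have hp := prime_fieldSize n
  have hlog := add_two_le_log_fieldSize_pow hn1
  have hqgt := pow_lt_fieldSize n
  have hqle := fieldSize_le n
  have hpar := @exists_isParam n
  simp only
  set q := fieldSize n with hqdef
  have hq1 : (1 : ℝ) < q := by exact_mod_cast hp.one_lt
  set N : ℝ := ((q ^ n : ℕ) : ℝ) with hN
  have hN1 : 1 < N := by
    rw [hN]
    exact_mod_cast Nat.one_lt_pow (by omega) hp.one_lt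
  have hN0 : 0 < N := by linarith
  set x := N ^ δ with hx
  set K := ⌊x⌋₊ with hK
  have hx0 : 0 ≤ x := Real.rpow_nonneg hN0.le _
  have hKx : (K : ℝ) ≤ x := Nat.floor_le hx0
  -- since `N ^ δ = q ^ (n * δ)`, this forces `s` to be large
  have hqK : q ^ 20606 ≤ K := by
    refine Nat.le_floor ?_
    push_cast
    rw [hx, hN]
    push_cast
    rw [← Real.rpow_natCast (q : ℝ) n, ← Real.rpow_mul (by linarith), ← Real.rpow_natCast]
    refine Real.rpow_le_rpow_of_exponent_le hq1.le ?_
    have h1 : (n₁ : ℝ) ≤ n := by exact_mod_cast hnn₁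
    rw [div_lt_iff₀ hδ0] at hn₁
    push_cast
    linarith only [hn₁, mul_le_mul_of_nonneg_right h1 hδ0.le]
  have hK1 : 1 < K := lt_of_lt_of_le (Nat.one_lt_pow (by omega) hp.one_lt) hqK
  -- `K ^ 101` is at most `N ^ (101 * δ)`
  have hK101 : (K : ℝ) ^ 101 ≤ (N ^ (1.01 * δ)) ^ 100 := by
    calc (K : ℝ) ^ 101 ≤ x ^ 101 := pow_le_pow_left₀ (Nat.cast_nonneg _) hKx _
      _ = (N ^ (1.01 * δ)) ^ 100 := by
        rw [hx, ← Real.rpow_mul_natCast hN0.le, ← Real.rpow_mul_natCast hN0.le]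
        congr 1
        push_cast
        ring
  have hKN : K ^ 101 ≤ (q ^ n) ^ 100 := by
    have h1 : N ^ (1.01 * δ) ≤ N ^ (1 : ℝ) :=
      Real.rpow_le_rpow_of_exponent_le hN1.le (by linarith)
    rw [Real.rpow_one] at h1
    have h2 := hK101.trans (pow_le_pow_left₀ (Real.rpow_nonneg hN0.le _) h1 100)
    rw [hN] at h2
    exact_mod_cast h2
  obtain ⟨s, hs⟩ := hpar hn1 hK1 hKN
  have hs20604 : 20604 ≤ s + 1 := by
    have := le_of_pow_le_of_pow_le_pow hp.one_lt hqK hs.pow_le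
    exact le_trans (by norm_num) this
  refine ⟨q, q ^ (s + 1), q ^ (n - s), multiplicityGraph q n s hp.one_lt hs.n_pos hs.s_lt.le,
    hs.describes, ?_, ?_, ?_, ?_⟩
  · calc (q : ℝ) ≤ 2 * ((n + 2 : ℕ) : ℝ) ^ 204 := by exact_mod_cast hqle
      _ ≤ 2 * Real.log N ^ 204 := by gcongr
  · refine le_of_pow_le_pow_left₀ (n := 100) (by norm_num) (Nat.cast_nonneg _) ?_
    -- the factor `N ^ η = 4` makes up for rounding `x` down to `K ≥ x / 2`
    have hη : N ^ (Real.log 4 / Real.log N) = 4 := by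
      rw [Real.rpow_def_of_pos hN0, mul_div_cancel₀ _ (Real.log_pos hN1).ne',
        Real.exp_log (by norm_num)]
    have hxK : x / 2 ≤ K := by
      have h1 := Nat.lt_floor_add_one x
      have h2 : (1 : ℝ) ≤ K := by exact_mod_cast hK1.le
      linarith
    have h1 : (x / 2) ^ 101 ≤ ((q ^ (s + 1) : ℕ) : ℝ) ^ 100 := by
      refine (pow_le_pow_left₀ (div_nonneg hx0 (by norm_num)) hxK 101).trans ?_
      have := hs.pow_le
      rw [mul_comm, pow_mul] at this
      exact_mod_cast this
    refine le_trans ?_ h1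
    rw [Real.rpow_sub hN0, hη, div_pow, div_pow]
    have e : (N ^ (1.01 * δ)) ^ 100 = x ^ 101 := by
      rw [hx, ← Real.rpow_mul_natCast hN0.le, ← Real.rpow_mul_natCast hN0.le]
      congr 1
      push_cast
      ring
    rw [e]
    exact div_le_div_of_nonneg_left (pow_nonneg hx0 _) (by norm_num) (by norm_num)
  · have h1 : (q : ℝ) ^ s ≤ N ^ (1.01 * δ) := by
      refine le_of_pow_le_pow_left₀ (n := 100) (by norm_num) (Real.rpow_nonneg hN0.le _) ?_
      refine le_trans ?_ hK101
      have := (hs.lt_pow s (by omega)).le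
      rw [mul_comm, pow_mul] at this
      exact_mod_cast this
    push_cast
    rw [pow_succ, mul_comm]
    exact mul_le_mul_of_nonneg_left h1 (by linarith)
  · exact isTwoSidedLossless_multiplicityGraph hp hn200 hs20604 hs.s_lt
      ((Nat.pow_le_pow_left (by omega) 204).trans_lt hqgt) hs.pow_le rfl
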